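/- Let $\mathbf k$ be an algebraically closed field of characteristic $0$, let $C$ be a smooth (integral, separated, of finite type) algebraic curve over $\mathbf k$, affine or projective, let $N$ be a lattice (a free abelian group of finite rank), $M=\mathrm{Hom}(N,\mathbb Z)$, $N_{\mathbb Q}=\mathbb Q\otimes N$, $M_{\mathbb Q}=\mathbb Q\otimes M$, and let $\mathbf k(C)[M]=\bigoplus_{m\in M}\mathbf k(C)\chi^m$. Let $m_1,\dots,m_r\in M$, let $f_1,\dots,f_r\in\mathbf k(C)^\star$, and put $$A=\mathbf k[C][f_1\chi^{m_1},\dots,f_r\chi^{m_r}]\subset\mathbf k(C)[M].$$ Assume that $A$ has the same fraction field as $\mathbf k(C)[M]$ and that its part of degree $0$ is $A\cap\mathbf k(C)=\mathbf k[C]$. Let $\sigma=\{v\in N_{\mathbb Q}: m_i(v)\ge 0,\ i=1,\dots,r\}$ be the dual of the cone $\sum_i\mathbb Q_{\ge0}m_i$, and for each (closed) point $z\in C$ let $$\Delta_z[f]=\{v\in N_{\mathbb Q}:\ m_i(v)\ge-\mathrm{ord}_z f_i,\ i=1,\dots,r\}.$$ Then $\sigma$ is a strongly convex polyhedral cone,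 $\mathfrak D[f]=\sum_{z\in C}\Delta_z[f]\cdot z$ is a proper $\sigma$-polyhedral divisor on $C$, the normalization $\bar A$ of $A$ (its integral closure in its fraction field) satisfies $\bar A=A[C,\mathfrak D[f]]$, and $\mathfrak D[f]$ is the unique proper $\sigma$-polyhedral divisor $\mathfrak D$ on $C$ with $\bar A=A[C,\mathfrak D]$. Here a $\sigma$-polyhedron is a Minkowski sum of $\sigma$ and a nonempty polytope in $N_{\mathbb Q}$; a $\sigma$-polyhedral divisor is a formal sum $\mathfrak D=\sum_{z\in C}\Delta_z\cdot z$ of $\sigma$-polyhedra with $\Delta_z=\sigma$ for all but finitely many $z$; for $m\in\sigma^\vee$ its evaluation is the rational divisor $\mathfrak D(m)=\sum_z\min_{v\in\Delta_z}m(v)\cdot z$; and $A[C,\mathfrak D]=\bigoplus_{m\in\sigma^\vee\cap M}H^0(C,\mathcal O_C(\lfloor\mathfrak D(m)\rfloor))\chi^m$. The divisor $\mathfrak D$ is proper if for every $m\in\sigma^\vee\cap M$ the divisor $\mathfrak D(m)$ is semi-ample (some positive integral multiple is base point free), and is moreover big when $m$ lies in the relative interior of $\sigma^\vee$ (for some integral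 multiple $s\mathfrak D(m)$, $s>0$, the dimension of $H^0(C,\mathcal O_C(rs\mathfrak D(m)))$ grows at least linearly in $r$; this is automatic if $C$ is affine). -/

import Mathlib

open AlgebraicGeometry CategoryTheory Order Filter
open scoped TensorProduct Pointwise

universe u v

/-- A smooth algebraic curve over a field `k`: an integral scheme, separated, of finite type and
smooth of relative dimension one over `k`. It may be affine or complete. -/
structure SmoothCurve (k : Type u) [Field k] where
  /-- the underlying scheme -/
  X : Scheme.{u}
  /-- the structure morphism -/
  str : X ⟶ Spec (CommRingCat.of k)
  isIntegral : IsIntegral X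
  isSeparated : IsSeparated str
  quasiCompact : QuasiCompact str
  smooth : SmoothOfRelativeDimension 1 str

namespace SmoothCurve

variable {k : Type u} [Field k] (C : SmoothCurve k)

instance : IsIntegral C.X := C.isIntegral

instance : IsLocallyNoetherian C.X :=
  haveI := C.smooth
  haveI := SmoothOfRelativeDimension.smooth 1 C.str
  haveI : IsLocallyNoetherian (Spec (CommRingCat.of k)) := inferInstance
  LocallyOfFiniteType.isLocallyNoetherian C.str

/-- The points `z ∈ C` that occur in divisors: the points of codimension one of the scheme, which
on a curve are exactly the closed points. -/
abbrev Point : Type u := {z : C.X // coheight z = 1}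

/-- The field of rational functions `k(C)`. -/
abbrev RatFun : Type u := C.X.functionField

/-- The algebra of global regular functions `k[C]`. -/
abbrev Reg : Type u := Γ(C.X, ⊤)

instance : Nonempty (⊤ : C.X.Opens) := ⟨⟨genericPoint C.X, trivial⟩⟩

/-- The inclusion of the constants `k → k[C]`. -/
noncomputable def const : k →+* C.Reg :=
  (C.str.appTop).hom.comp (Scheme.ΓSpecIso (CommRingCat.of k)).inv.hom

noncomputable instance : Algebra k C.RatFun :=
  ((algebraMap C.Reg C.RatFun).comp C.const).toAlgebra

/-- The order of vanishing `ord_z g` of a rational function (of no significance for `g = 0`). -/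
noncomputable def ord (z : C.Point) (g : C.RatFun) : ℤ := Scheme.ord g z.1

/-- The space `H⁰(C, 𝒪_C(⌊D⌋)) ⊂ k(C)` for a rational Weil divisor `D`: all `g` with `g = 0` or
`div g + ⌊D⌋ ≥ 0`. -/
def sections (D : C.Point → ℚ) : Set C.RatFun :=
  {g | g ≠ 0 → ∀ z, 0 ≤ C.ord z g + ⌊D z⌋}

/-- A rational Weil divisor is integral if its coefficients are integers. -/
def IsIntegralDiv (D : C.Point → ℚ) : Prop := ∀ z, ∃ n : ℤ, D z = n

/-- A rational divisor is semi-ample if some positive integral multiple `s D` is base point free: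
at each point `z` some global section of `𝒪_C(s D)` does not vanish. -/
def IsSemiample (D : C.Point → ℚ) : Prop :=
  ∃ s : ℕ, 0 < s ∧ C.IsIntegralDiv ((s : ℚ) • D) ∧
    ∀ z, ∃ g ∈ C.sections ((s : ℚ) • D), g ≠ 0 ∧ (C.ord z g : ℚ) + (s : ℚ) * D z = 0

/-- A rational divisor on a curve is big if for some positive integral multiple `s D` the dimension
of `H⁰(C, 𝒪_C(r s D))` grows at least linearly in `r`, i.e. is at least `r / c` for some constant
`c` and all large `r`. On an affine curve these spaces are infinite-dimensional, so there
every rational divisor is big. -/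
def IsBig (D : C.Point → ℚ) : Prop :=
  ∃ s : ℕ, 0 < s ∧ C.IsIntegralDiv ((s : ℚ) • D) ∧ ∃ c : ℕ, ∀ᶠ r : ℕ in atTop,
    (r : Cardinal.{u}) ≤
      c * Module.rank k (Submodule.span k (C.sections (((r * s : ℕ) : ℚ) • D)))

end SmoothCurve

section Lattice

variable (N : Type v) [AddCommGroup N]

/-- The lattice `M = Hom(N, ℤ)` dual to `N`. -/
abbrev LatM : Type v := Module.Dual ℤ N

/-- The rational vector space `N_ℚ = ℚ ⊗ N`. -/
abbrev NQ : Type v := ℚ ⊗[ℤ] N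

/-- The rational vector space `M_ℚ`, realized as the dual of `N_ℚ`. -/
abbrev MQ : Type v := Module.Dual ℚ (NQ N)

variable {N}

/-- The canonical map `M → M_ℚ`; `(toMQ m) (q ⊗ n) = q * m n`. -/
noncomputable def toMQ (m : LatM N) : MQ N := Module.Dual.baseChange ℚ m

theorem toMQ_tmul (m : LatM N) (q : ℚ) (n : N) : toMQ m (q ⊗ₜ[ℤ] n) = q * (m n : ℚ) := by
  simp [toMQ, mul_comm]

/-- The dual cone `σ^∨ ⊂ M_ℚ` of a cone `σ ⊂ N_ℚ`. -/
def dualCone (σ : PointedCone ℚ (NQ N)) : PointedCone ℚ (MQ N) :=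
  PointedCone.dual (Module.Dual.eval ℚ (NQ N)) (σ : Set (NQ N))

/-- The dual cone in `N_ℚ` of a cone in `M_ℚ`. -/
def dualConeN (ω : PointedCone ℚ (MQ N)) : PointedCone ℚ (NQ N) :=
  PointedCone.dual (LinearMap.id : MQ N →ₗ[ℚ] MQ N) (ω : Set (MQ N))

/-- The relative interior of a convex set in a rational vector space: the points of `S` from which
every segment coming from a point of `S` can be prolonged a little inside `S`. -/
def relInterior {V : Type*} [AddCommGroup V] [Module ℚ V] (S : Set V) : Set V :=
  {x | x ∈ S ∧ ∀ y ∈ S, ∃ ε : ℚ, 0 < ε ∧ x + ε • (x - y) ∈ S}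

/-- `Δ` is a `σ`-polyhedron: the Minkowski sum of `σ` and of a (nonempty) polytope. -/
def IsTailPolyhedron (σ : PointedCone ℚ (NQ N)) (Δ : Set (NQ N)) : Prop :=
  ∃ Q : Finset (NQ N), Q.Nonempty ∧ Δ = (σ : Set (NQ N)) + convexHull ℚ (Q : Set (NQ N))

open scoped Classical in
/-- The support function `h_Δ(m) = min_{v ∈ Δ} m(v)` (with value `0` if there is no minimum, which
does not happen for a `σ`-polyhedron `Δ` and `m ∈ σ^∨`). -/
noncomputable def supportFun (Δ : Set (NQ N)) (m : MQ N) : ℚ :=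
  if h : ∃ q : ℚ, IsLeast (m '' Δ) q then h.choose else 0

theorem isLeast_supportFun {σ : PointedCone ℚ (NQ N)} {Δ : Set (NQ N)}
    (hΔ : IsTailPolyhedron σ Δ) {m : MQ N} (hm : m ∈ dualCone σ) :
    IsLeast (m '' Δ) (supportFun Δ m) := by
  have h : ∃ q : ℚ, IsLeast (m '' Δ) q := by
    obtain ⟨Q, hQ, rfl⟩ := hΔ
    obtain ⟨v, hv, hmin⟩ := Q.exists_min_image (fun v => m v) hQ
    refine ⟨m v, ⟨v, ?_, rfl⟩, ?_⟩
    · exact ⟨0, σ.zero_mem, v, subset_convexHull ℚ _ hv, zero_add v⟩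
    · rintro _ ⟨_, ⟨s, hs, w, hw, rfl⟩, rfl⟩
      have hs' : 0 ≤ m s := hm hs
      have hconv : Convex ℚ {x : NQ N | m v ≤ m x} :=
        convex_halfSpace_ge m.isLinear (m v)
      have hw' : m v ≤ m w := convexHull_min (fun x hx => hmin x hx) hconv hw
      simp only [map_add]
      linarith
  rw [supportFun, dif_pos h]
  exact h.choose_spec

end Lattice

/-- A `σ`-polyhedral divisor `𝔇 = ∑ Δ_z · z` on the curve `C`. -/
@[ext]
structure PolyhedralDivisor {k : Type u} [Field k] (C : SmoothCurve k) {N : Type v}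
    [AddCommGroup N] (σ : PointedCone ℚ (NQ N)) where
  /-- the coefficient `Δ_z` at `z` -/
  coeff : C.Point → Set (NQ N)
  isTail : ∀ z, IsTailPolyhedron σ (coeff z)
  finite : {z | coeff z ≠ (σ : Set (NQ N))}.Finite

namespace PolyhedralDivisor

variable {k : Type u} [Field k] {C : SmoothCurve k} {N : Type v} [AddCommGroup N]
  {σ : PointedCone ℚ (NQ N)} (D : PolyhedralDivisor C σ)

/-- The evaluation `𝔇(m) = ∑ h_{Δ_z}(m) · z`, a rational divisor on `C`. -/
noncomputable def eval (m : MQ N) : C.Point → ℚ := fun z => supportFun (D.coeff z) m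

/-- `𝔇` is proper: `𝔇(m)` is semi-ample for all `m ∈ σ^∨ ∩ M`, and big if `m` lies moreover in the
relative interior of `σ^∨`. -/
def IsProper : Prop :=
  ∀ m : LatM N, toMQ m ∈ dualCone σ →
    C.IsSemiample (D.eval (toMQ m)) ∧
      (toMQ m ∈ relInterior (dualCone σ : Set (MQ N)) → C.IsBig (D.eval (toMQ m)))

/-- The subset `A[C, 𝔇] = ⨁_{m ∈ σ^∨ ∩ M} H⁰(C, 𝒪_C(⌊𝔇(m)⌋)) χ^m` of `k(C)[M]`. -/
def sectionAlgebra : Set (AddMonoidAlgebra C.RatFun (LatM N)) :=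
  {x | ∀ m : LatM N, x.coeff m ≠ 0 →
    toMQ m ∈ dualCone σ ∧ x.coeff m ∈ C.sections (D.eval (toMQ m))}

end PolyhedralDivisor

section Generators

variable {k : Type u} [Field k] (C : SmoothCurve k) {N : Type v} [AddCommGroup N]
  {r : ℕ} (f : Fin r → C.RatFun) (m : Fin r → LatM N)

/-- The algebra `A = k[C][f₁ χ^{m₁}, …, f_r χ^{m_r}] ⊂ k(C)[M]`. -/
noncomputable def genAlgebra : Subalgebra C.Reg (AddMonoidAlgebra C.RatFun (LatM N)) :=
  Algebra.adjoin C.Reg (Set.range fun i => AddMonoidAlgebra.single (m i) (f i))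

/-- The cone `σ ⊂ N_ℚ` dual to the cone `∑ ℚ_{≥ 0} m_i`. -/
noncomputable def genCone : PointedCone ℚ (NQ N) :=
  dualConeN (PointedCone.hull ℚ (Set.range fun i => toMQ (m i)))

/-- `Δ_z[f] = {v ∈ N_ℚ : m_i(v) ≥ -ord_z f_i for all i}`. -/
def genPolyhedron (z : C.Point) : Set (NQ N) :=
  {v | ∀ i, -(C.ord z (f i) : ℚ) ≤ toMQ (m i) v}

/-- The normalization of `A` (its integral closure in the fraction field `Frac k(C)[M]`, which is
the fraction field of `A` in the situation of interest) is the subset `B` of `k(C)[M]`. -/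
def IsNormalization (A : Subalgebra C.Reg (AddMonoidAlgebra C.RatFun (LatM N)))
    (B : Set (AddMonoidAlgebra C.RatFun (LatM N))) : Prop :=
  (integralClosure A (FractionRing (AddMonoidAlgebra C.RatFun (LatM N))) :
      Set (FractionRing (AddMonoidAlgebra C.RatFun (LatM N)))) =
    algebraMap (AddMonoidAlgebra C.RatFun (LatM N))
      (FractionRing (AddMonoidAlgebra C.RatFun (LatM N))) '' B

end Generators

/-! Everything is tested degree by degree, with valuations on one side and linear programming on the
other.

Integral elements are sections. For `v` in `Δ_z[f]` the Gauss valuation `∑ g_μ χ^μ ↦ min (ord_z g_μ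
+ μ(v))` is nonnegative on the generators, hence on `A` and on every element integral over `A`.
Taking `v` where `μ` is minimal on `Δ_z[f]` gives the bound on `ord_z g_μ`; the trivial order and
`v` in `σ` give `μ ∈ σ^∨` (`coeff_bound_of_isIntegral`, `mem_sectionAlgebra_of_isIntegral`). Since
`k(C)[M]` is integrally closed, nothing integral lies outside it.

Sections are integral. The integral closure is the intersection of the valuation rings `V ⊇ A`. The
trace of `V` on `k(C)` contains `k[C]`, so it is trivial or contains the local ring of some `z`
(`eq_top_or_exists_localRing_le`): otherwise a function with its only pole at that place would be
regular on `C`, hence in `k[C]`. Linear programming duality with cleared denominators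
(`exists_monomial`) gives a monomial `f^a` of degree `s μ` with `ord_z f^a = -s 𝔇(μ)(z)`. For a
section `g χ^μ` the quotient `g^s / f^a` is regular at `z`, so `(g χ^μ)^s ∈ V`, and `V` is
integrally closed.

The same monomials give semi-ampleness: each is a section of `s 𝔇(μ)`, and the one optimal at `z`
generates there. One `s` serves all `z` because only finitely many vectors `ord_z f` occur. `Δ_z[f]`
is nonempty because Farkas' certificate of emptiness would be a monomial of degree `0` with a pole
at `z`. Equality of fraction fields makes `σ` salient, and writes a transcendental function as a
ratio of two sections of the same degree, whence bigness in the interior of `σ^∨`. Uniqueness holds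
because semi-ampleness recovers the support functions from the sections, and these determine the
polyhedra by separation. -/

/-! ### Finitely generated cones and Farkas' lemma -/

section Cones

open Module PointedCone

variable {R : Type*} [Field R] [LinearOrder R] [IsStrictOrderedRing R]
  {V : Type*} [AddCommGroup V] [Module R V]

theorem PointedCone.nonneg_of_mem_hull {s : Set V} {l : Dual R V} (hl : ∀ y ∈ s, 0 ≤ l y) {x : V}
    (hx : x ∈ hull R s) : 0 ≤ l x := by
  induction hx using Submodule.span_induction with
  | mem x h => exact hl x h
  | zero => simp
  | add x y _ _ hx hy => rw [map_add]; exact add_nonneg hx hy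
  | smul a x _ hx => rw [← Nonneg.coe_smul, map_smul]; exact mul_nonneg a.2 hx

theorem PointedCone.mem_hull_range_iff {ι : Type*} [Fintype ι] (v : ι → V) {x : V} :
    x ∈ hull R (Set.range v) ↔ ∃ c : ι → R, (∀ i, 0 ≤ c i) ∧ ∑ i, c i • v i = x := by
  rw [PointedCone.hull, Submodule.mem_span_range_iff_exists_fun]
  constructor
  · rintro ⟨c, rfl⟩
    exact ⟨fun i => c i, fun i => (c i).2, by simp [Nonneg.coe_smul]⟩
  · rintro ⟨c, hc, rfl⟩
    exact ⟨fun i => ⟨c i, hc i⟩, rfl⟩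

open scoped Classical in
/-- A finitely generated cone is cut out by finitely many inequalities (Fourier-Motzkin). -/
theorem PointedCone.exists_finset_dual_eq_hull [FiniteDimensional R V] (s : Finset V) :
    ∃ T : Finset (Dual R V), ∀ x, x ∈ hull R (s : Set V) ↔ ∀ l ∈ T, 0 ≤ l x := by
  induction s using Finset.induction with
  | empty =>
    let b := Module.finBasis R V
    refine ⟨Finset.univ.image b.coord ∪ Finset.univ.image fun i => -b.coord i, fun x => ?_⟩
    constructor
    · intro hx
      have : x = 0 := by simpa [hull] using hx
      simp [this]
    · intro h
      have hx : x = 0 := by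
        refine b.ext_elem fun i => ?_
        have h1 := h (b.coord i) (by simp)
        have h2 := h (-b.coord i) (by simp)
        simp only [Basis.coord_apply, LinearMap.neg_apply] at h1 h2
        simp only [map_zero, Finsupp.coe_zero, Pi.zero_apply]
        linarith
      simp [hx]
  | insert g s _ ih =>
    obtain ⟨T, hT⟩ := ih
    -- The condition is that `x - t • g` satisfies `T` for some `t ≥ 0`. Eliminating `t` keeps the
    -- inequalities that hold at `g` and combines each pair of opposite signs at `g` into one that
    -- vanishes at `g`.
    refine ⟨{l ∈ T | 0 ≤ l g} ∪
      Finset.image₂ (fun l k => l g • k - k g • l) {l ∈ T | 0 < l g} {k ∈ T | k g < 0},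
      fun x => ?_⟩
    have hins : x ∈ hull R (insert g s : Finset V) ↔ ∃ t : R, 0 ≤ t ∧ x - t • g ∈ hull R (s : Set V) := by
      rw [Finset.coe_insert, hull, Submodule.mem_span_insert]
      constructor
      · rintro ⟨a, z, hz, rfl⟩
        refine ⟨a, a.2, ?_⟩
        rwa [Nonneg.coe_smul, add_sub_cancel_left]
      · rintro ⟨t, ht, hz⟩
        refine ⟨⟨t, ht⟩, _, hz, ?_⟩
        rw [← Nonneg.coe_smul]; simp
    rw [hins]
    simp only [hT, map_sub, map_smul, smul_eq_mul]
    constructor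
    · rintro ⟨t, ht, h⟩ l hl
      rcases Finset.mem_union.1 hl with hl | hl
      · have := h l (Finset.mem_filter.1 hl).1
        have := mul_nonneg ht (Finset.mem_filter.1 hl).2
        linarith
      · obtain ⟨l, hl', k, hk', rfl⟩ := Finset.mem_image₂.1 hl
        obtain ⟨hl, hlg⟩ := Finset.mem_filter.1 hl'
        obtain ⟨hk, hkg⟩ := Finset.mem_filter.1 hk'
        have h1 := mul_nonneg hlg.le (h k hk)
        have h2 := mul_nonneg (neg_nonneg.2 hkg.le) (h l hl)
        simp only [LinearMap.sub_apply, LinearMap.smul_apply, smul_eq_mul]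
        linarith
    · intro h
      have hpos : ∀ l ∈ T, 0 ≤ l g → 0 ≤ l x := fun l hl hlg =>
        h l (Finset.mem_union_left _ (Finset.mem_filter.2 ⟨hl, hlg⟩))
      have hmix : ∀ l ∈ T, 0 < l g → ∀ k ∈ T, k g < 0 → 0 ≤ l g * k x - k g * l x :=
        fun l hl hlg k hk hkg => by
          simpa using h _ (Finset.mem_union_right _ (Finset.mem_image₂_of_mem
            (Finset.mem_filter.2 ⟨hl, hlg⟩) (Finset.mem_filter.2 ⟨hk, hkg⟩)))
      rcases ({k ∈ T | k g < 0} : Finset (Dual R V)).eq_empty_or_nonempty with hemp | hne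
      · refine ⟨0, le_rfl, fun l hl => ?_⟩
        have : ¬ l g < 0 := fun hlt =>
          (Finset.notMem_empty l) (hemp ▸ Finset.mem_filter.2 ⟨hl, hlt⟩)
        simpa using hpos l hl (not_lt.1 this)
      · obtain ⟨k, hk, hmax⟩ := Finset.exists_max_image _ (fun k : Dual R V => k x / k g) hne
        obtain ⟨hkT, hkg⟩ := Finset.mem_filter.1 hk
        -- The inequalities negative at `g` bound `t` from below by `k x / k g`; the smallest
        -- admissible `t` is the best choice for the remaining ones, which bound it from above.
        refine ⟨max 0 (k x / k g), le_max_left _ _, fun l hl => ?_⟩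
        rcases lt_trichotomy (l g) 0 with hlg | hlg | hlg
        · have h1 := (hmax l (Finset.mem_filter.2 ⟨hl, hlg⟩)).trans (le_max_right 0 _)
          rw [div_le_iff_of_neg hlg] at h1
          linarith
        · simpa [hlg] using hpos l hl hlg.ge
        · rw [sub_nonneg, ← le_div_iff₀ hlg]
          refine max_le (div_nonneg (hpos l hl hlg.le) hlg.le) ?_
          rw [div_le_iff_of_neg hkg, div_mul_eq_mul_div, div_le_iff₀ hlg]
          linarith [hmix l hl hlg k hkT hkg]

/-- Farkas' lemma. -/
theorem PointedCone.exists_dual_neg_of_notMem_hull [FiniteDimensional R V] {s : Set V}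
    (hs : s.Finite) {x : V} (hx : x ∉ hull R s) :
    ∃ l : Dual R V, (∀ y ∈ s, 0 ≤ l y) ∧ l x < 0 := by
  obtain ⟨T, hT⟩ := exists_finset_dual_eq_hull (R := R) hs.toFinset
  simp only [Set.Finite.coe_toFinset] at hT
  rw [hT] at hx
  push Not at hx
  obtain ⟨l, hl, hlx⟩ := hx
  exact ⟨l, fun y hy => (hT y).1 (Submodule.subset_span hy) l hl, hlx⟩

open scoped Classical in
/-- A cone cut out by finitely many inequalities is finitely generated. -/
theorem PointedCone.exists_finset_hull_eq_dual [FiniteDimensional R V] {T : Set (Dual R V)}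
    (hT : T.Finite) :
    ∃ S : Finset V, ∀ x, x ∈ hull R (S : Set V) ↔ ∀ l ∈ T, 0 ≤ l x := by
  obtain ⟨U, hU⟩ := exists_finset_dual_eq_hull (R := R) hT.toFinset
  simp only [Set.Finite.coe_toFinset] at hU
  -- By biduality, the inequalities that cut out the cone spanned by `T` in the dual space are
  -- points of `V`; these points are the generators sought.
  have hU' : ∀ l, l ∈ hull R T ↔ ∀ v ∈ U.image (evalEquiv R V).symm, 0 ≤ l v := by
    intro l
    rw [hU]
    simp
  refine ⟨U.image (evalEquiv R V).symm, fun x => ⟨fun hx l hl => ?_, fun h => ?_⟩⟩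
  · exact nonneg_of_mem_hull (fun y hy => (hU' l).1 (Submodule.subset_span hl) y hy) hx
  · by_contra hx
    obtain ⟨l, hl, hlx⟩ := exists_dual_neg_of_notMem_hull (Finset.finite_toSet _) hx
    have hl' : l ∈ hull R T := (hU' l).2 hl
    have := nonneg_of_mem_hull (l := Dual.eval R V x) (fun k hk => h k hk) hl'
    simp only [Dual.eval_apply] at this
    linarith

end Cones

/-! ### Polyhedra: affine duality, decomposition, separation -/

section Polyhedra

open Module PointedCone

variable {V : Type*} [AddCommGroup V] [Module ℚ V] [FiniteDimensional ℚ V]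
  {ι : Type*} [Fintype ι]

theorem dual_prod_apply {R V : Type*} [CommRing R] [AddCommGroup V] [Module R V]
    (L : Dual R (V × R)) (x : V) (t : R) :
    L (x, t) = L.comp (LinearMap.inl R V R) x + t * L (0, 1) := by
  have : (x, t) = (x, (0 : R)) + t • ((0 : V), (1 : R)) := by simp
  rw [this, map_add, map_smul]
  simp

/-- Affine Farkas lemma: an inequality `h ≤ l v` valid on the nonempty polyhedron
`{v | ∀ i, b i ≤ m i v}` is a consequence of a nonnegative combination of its inequalities. -/
theorem exists_nonneg_combination (m : ι → Dual ℚ V) (b : ι → ℚ)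
    (hne : ∃ v, ∀ i, b i ≤ m i v) (l : Dual ℚ V) (h : ℚ)
    (hl : ∀ v, (∀ i, b i ≤ m i v) → h ≤ l v) :
    ∃ c : ι → ℚ, (∀ i, 0 ≤ c i) ∧ ∑ i, c i • m i = l ∧ h ≤ ∑ i, c i * b i := by
  -- Homogenization: `(m i, -b i)` encodes `m i v - b i ≥ 0`, and the extra generator `(0, 1)`
  -- absorbs the slack in the constant term.
  let w : Option ι → Dual ℚ V × ℚ := fun o => o.elim (0, 1) fun i => (m i, -b i)
  by_cases hmem : (l, -h) ∈ hull ℚ (Set.range w)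
  · obtain ⟨c, hc, hsum⟩ := (mem_hull_range_iff w).1 hmem
    rw [Fintype.sum_option, Prod.ext_iff] at hsum
    obtain ⟨h1, h2⟩ := hsum
    refine ⟨fun i => c (some i), fun i => hc _, ?_, ?_⟩
    · simpa [w, Prod.fst_sum] using h1
    · simp [w, Prod.snd_sum] at h2
      linarith [hc none]
  · exfalso
    obtain ⟨L, hL, hLx⟩ := exists_dual_neg_of_notMem_hull (Set.finite_range w) hmem
    obtain ⟨v, hv⟩ := (evalEquiv ℚ V).surjective (L.comp (LinearMap.inl ℚ (Dual ℚ V) ℚ))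
    have hLv : ∀ (k : Dual ℚ V) (t : ℚ), L (k, t) = k v + t * L (0, 1) := fun k t => by
      rw [dual_prod_apply, ← hv]; simp
    have h0 : 0 ≤ L (0, 1) := hL _ ⟨none, rfl⟩
    have hi : ∀ i, b i * L (0, 1) ≤ m i v := fun i => by
      have : 0 ≤ L (m i, -b i) := hL _ ⟨some i, rfl⟩
      rw [hLv] at this
      linarith
    rw [hLv] at hLx
    -- If the separating functional vanishes on `(0, 1)`, then `v` is a recession direction along
    -- which `l` tends to `-∞`; otherwise rescaling `v` gives a point of the polyhedron that
    -- violates `h ≤ l`.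
    rcases h0.eq_or_lt with h0 | h0
    · rw [← h0] at hLx hi
      obtain ⟨v₀, hv₀⟩ := hne
      have hlv : l v < 0 := by linarith
      obtain ⟨n, hn⟩ : ∃ n : ℚ, 0 ≤ n ∧ l v₀ + n * l v < h := by
        refine ⟨max 0 ((h - l v₀) / l v + 1), le_max_left _ _, ?_⟩
        have : (h - l v₀) / l v < max 0 ((h - l v₀) / l v + 1) := by
          exact (lt_add_one _).trans_le (le_max_right _ _)
        rw [div_lt_iff_of_neg hlv] at this
        linarith
      have := hl (v₀ + n • v) fun i => by
        have := mul_nonneg hn.1 ((zero_eq_mul.2 (Or.inr rfl)).trans_le (hi i))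
        simp only [map_add, map_smul, smul_eq_mul]
        linarith [hv₀ i]
      simp only [map_add, map_smul, smul_eq_mul] at this
      linarith
    · have := hl ((L (0, 1))⁻¹ • v) fun i => by
        rw [map_smul, smul_eq_mul, le_inv_mul_iff₀ h0, mul_comm]
        exact hi i
      rw [map_smul, smul_eq_mul, le_inv_mul_iff₀ h0] at this
      linarith

/-- An empty polyhedron has a certificate of emptiness. -/
theorem exists_nonneg_combination_of_empty (m : ι → Dual ℚ V) (b : ι → ℚ)
    (hne : ¬ ∃ v, ∀ i, b i ≤ m i v) :
    ∃ c : ι → ℚ, (∀ i, 0 ≤ c i) ∧ ∑ i, c i • m i = 0 ∧ 0 < ∑ i, c i * b i := by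
  let w : Option ι → Dual ℚ V × ℚ := fun o => o.elim (0, 1) fun i => (m i, -b i)
  by_cases hmem : ((0 : Dual ℚ V), (-1 : ℚ)) ∈ hull ℚ (Set.range w)
  · obtain ⟨c, hc, hsum⟩ := (mem_hull_range_iff w).1 hmem
    rw [Fintype.sum_option, Prod.ext_iff] at hsum
    obtain ⟨h1, h2⟩ := hsum
    refine ⟨fun i => c (some i), fun i => hc _, ?_, ?_⟩
    · simpa [w, Prod.fst_sum] using h1
    · simp [w, Prod.snd_sum] at h2
      linarith [hc none]
  · exfalso
    obtain ⟨L, hL, hLx⟩ := exists_dual_neg_of_notMem_hull (Set.finite_range w) hmem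
    obtain ⟨v, hv⟩ := (evalEquiv ℚ V).surjective (L.comp (LinearMap.inl ℚ (Dual ℚ V) ℚ))
    have hLv : ∀ (k : Dual ℚ V) (t : ℚ), L (k, t) = k v + t * L (0, 1) := fun k t => by
      rw [dual_prod_apply, ← hv]; simp
    rw [hLv] at hLx
    have h0 : 0 < L (0, 1) := by simpa using hLx
    refine hne ⟨(L (0, 1))⁻¹ • v, fun i => ?_⟩
    have : 0 ≤ L (m i, -b i) := hL _ ⟨some i, rfl⟩
    rw [hLv] at this
    rw [map_smul, smul_eq_mul, le_inv_mul_iff₀ h0]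
    linarith

open scoped Classical in
/-- A nonempty polyhedron is the sum of its recession cone and a polytope. -/
theorem exists_polyhedron_eq_add_convexHull (m : ι → Dual ℚ V) (b : ι → ℚ)
    (hne : ∃ v, ∀ i, b i ≤ m i v) :
    ∃ Q : Finset V, Q.Nonempty ∧
      {v | ∀ i, b i ≤ m i v} = {v | ∀ i, 0 ≤ m i v} + convexHull ℚ (Q : Set V) := by
  -- The polyhedron is the slice `t = 1` of a cone in `V × ℚ`. Generators of positive height,
  -- rescaled to height one, span the polytope; those of height zero lie in the recession cone.
  let w : Option ι → Dual ℚ (V × ℚ) := fun o => o.elim (LinearMap.snd ℚ V ℚ)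
    fun i => (m i).comp (LinearMap.fst ℚ V ℚ) - b i • LinearMap.snd ℚ V ℚ
  obtain ⟨S, hS⟩ := exists_finset_hull_eq_dual (Set.finite_range w)
  have hS' : ∀ v t, (v, t) ∈ hull ℚ (S : Set (V × ℚ)) ↔ 0 ≤ t ∧ ∀ i, b i * t ≤ m i v := by
    intro v t
    rw [hS]
    simp only [Set.forall_mem_range, Option.forall, w]
    simp
  have hmemS : ∀ p ∈ S, 0 ≤ p.2 ∧ ∀ i, b i * p.2 ≤ m i p.1 := fun p hp =>
    (hS' p.1 p.2).1 (Submodule.subset_span hp)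
  have hset : {v | ∀ i, b i ≤ m i v} = {v | ∀ i, 0 ≤ m i v} +
      convexHull ℚ (((S.filter fun p => 0 < p.2).image fun p => p.2⁻¹ • p.1 : Finset V) : Set V) := by
    apply Set.Subset.antisymm
    · intro v hv
      have hv1 : (v, (1 : ℚ)) ∈ hull ℚ (S : Set (V × ℚ)) := (hS' v 1).2 ⟨zero_le_one, by simpa using hv⟩
      rw [show (S : Set (V × ℚ)) = Set.range (fun p : S => (p : V × ℚ)) by simp] at hv1
      obtain ⟨c, hc, hsum⟩ := (mem_hull_range_iff _).1 hv1
      rw [Finset.sum_coe_sort S (fun p => if h : p ∈ S then c ⟨p, h⟩ • p else 0) |>.symm.trans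
        (Finset.sum_congr rfl fun p _ => by simp) |>.symm] at hsum
      set d : V × ℚ → ℚ := fun p => if h : p ∈ S then c ⟨p, h⟩ else 0 with hd
      have hd0 : ∀ p, 0 ≤ d p := fun p => by
        simp only [hd]; split_ifs
        · exact hc _
        · exact le_rfl
      have hsum' : ∑ p ∈ S, d p • p = (v, 1) := by
        rw [← hsum]
        refine Finset.sum_congr rfl fun p hp => ?_
        simp [hd, hp]
      have h1 : ∑ p ∈ S, d p • p.1 = v := by simpa [Prod.fst_sum] using congrArg Prod.fst hsum'
      have h2 : ∑ p ∈ S, d p * p.2 = 1 := by simpa [Prod.snd_sum] using congrArg Prod.snd hsum'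
      rw [← Finset.sum_filter_add_sum_filter_not S (fun p => 0 < p.2)] at h1 h2
      have hz : ∀ p ∈ S.filter (fun p => ¬ 0 < p.2), p.2 = 0 := fun p hp =>
        le_antisymm (not_lt.1 (Finset.mem_filter.1 hp).2) (hmemS p (Finset.mem_filter.1 hp).1).1
      rw [Finset.sum_eq_zero (s := S.filter (fun p => ¬ 0 < p.2)) (fun p hp => by rw [hz p hp, mul_zero]),
        add_zero] at h2
      refine ⟨∑ p ∈ S with ¬ 0 < p.2, d p • p.1, ?_, ∑ p ∈ S with 0 < p.2, d p • p.1, ?_, ?_⟩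
      · intro i
        rw [map_sum]
        refine Finset.sum_nonneg fun p hp => ?_
        have := (hmemS p (Finset.mem_filter.1 hp).1).2 i
        rw [hz p hp, mul_zero] at this
        rw [map_smul]
        exact mul_nonneg (hd0 p) this
      · have hcm : ∀ p ∈ S.filter (fun p => 0 < p.2), d p • p.1 = (d p * p.2) • (p.2⁻¹ • p.1) := by
          intro p hp
          have := (Finset.mem_filter.1 hp).2.ne'
          rw [smul_smul, mul_assoc, mul_inv_cancel₀ this, mul_one]
        change ∑ p ∈ S with 0 < p.2, d p • p.1 ∈ convexHull ℚ _
        rw [Finset.sum_congr rfl hcm]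
        refine (convex_convexHull ℚ _).sum_mem (fun p hp => ?_) h2 fun p hp => ?_
        · exact mul_nonneg (hd0 p) (Finset.mem_filter.1 hp).2.le
        · exact subset_convexHull ℚ _ (Finset.mem_coe.2 (Finset.mem_image_of_mem _ hp))
      · change (∑ p ∈ S with ¬ 0 < p.2, d p • p.1) + (∑ p ∈ S with 0 < p.2, d p • p.1) = v
        rw [add_comm]; exact h1
    · rintro _ ⟨x, hx, y, hy, rfl⟩ i
      have hconv : Convex ℚ {v | b i ≤ m i v} := convex_halfSpace_ge (m i).isLinear (b i)
      have hy' : b i ≤ m i y := by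
        refine convexHull_min ?_ hconv hy
        intro q hq
        obtain ⟨p, hp, rfl⟩ := Finset.mem_image.1 (Finset.mem_coe.1 hq)
        obtain ⟨hpS, hp0⟩ := Finset.mem_filter.1 hp
        change b i ≤ m i (p.2⁻¹ • p.1)
        rw [map_smul, smul_eq_mul, le_inv_mul_iff₀ hp0, mul_comm]
        exact (hmemS p hpS).2 i
      change b i ≤ m i (x + y)
      rw [map_add]
      linarith [hx i]
  refine ⟨_, ?_, hset⟩
  obtain ⟨v, hv⟩ := hne
  have hv' : v ∈ {v | ∀ i, b i ≤ m i v} := hv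
  rw [hset] at hv'
  obtain ⟨x, -, y, hy, -⟩ := hv'
  exact Finset.coe_nonempty.1 (convexHull_nonempty_iff.1 ⟨y, hy⟩)

/-- Points outside of the sum of a finitely generated cone and a polytope can be separated. -/
theorem exists_dual_lt_of_notMem_add_convexHull {σ : PointedCone ℚ V} (hσ : σ.FG) (Q : Finset V)
    {v : V} (hv : v ∉ (σ : Set V) + convexHull ℚ (Q : Set V)) :
    ∃ (l : Dual ℚ V) (h : ℚ), (∀ x ∈ σ, 0 ≤ l x) ∧ (∀ q ∈ Q, h ≤ l q) ∧ l v < h := by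
  obtain ⟨s, rfl⟩ := hσ
  -- With `σ` placed at height `0` and `Q` at height `1`, the slice of the resulting cone at height
  -- `1` is the Minkowski sum, so Farkas' lemma for cones applies.
  have hnot : (v, (1 : ℚ)) ∉ hull ℚ ((fun x => (x, (0 : ℚ))) '' (s : Set V) ∪
      (fun x => (x, (1 : ℚ))) '' (Q : Set V)) := by
    intro hmem
    rw [hull, Submodule.span_union, Submodule.mem_sup] at hmem
    obtain ⟨y, hy, z, hz, hyz⟩ := hmem
    have hy2 : y.2 = 0 ∧ y.1 ∈ hull ℚ (s : Set V) := by
      clear hyz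
      induction hy using Submodule.span_induction with
      | mem x h => obtain ⟨x, hx, rfl⟩ := h; exact ⟨rfl, Submodule.subset_span hx⟩
      | zero => exact ⟨rfl, zero_mem _⟩
      | add x y _ _ hx hy => exact ⟨by simp [hx.1, hy.1], add_mem hx.2 hy.2⟩
      | smul a x _ hx => exact ⟨by simp [hx.1], Submodule.smul_mem _ _ hx.2⟩
    have hz2 : 0 ≤ z.2 ∧ (z.2 = 0 → z.1 = 0) ∧
        (0 < z.2 → z.2⁻¹ • z.1 ∈ convexHull ℚ (Q : Set V)) := by
      clear hyz
      induction hz using Submodule.span_induction with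
      | mem x h =>
        obtain ⟨x, hx, rfl⟩ := h
        exact ⟨zero_le_one, by simp, fun _ => by simpa using subset_convexHull ℚ _ hx⟩
      | zero => exact ⟨le_rfl, fun _ => rfl, fun h => absurd h (lt_irrefl _)⟩
      | add x y _ _ hx hy =>
        refine ⟨add_nonneg hx.1 hy.1, fun h => ?_, fun h => ?_⟩
        · have h' : x.2 + y.2 = 0 := h
          rw [Prod.fst_add, hx.2.1 (by linarith [hx.1, hy.1]), hy.2.1 (by linarith [hx.1, hy.1]),
            add_zero]
        · rw [Prod.fst_add, Prod.snd_add]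
          rcases hx.1.eq_or_lt with h1 | h1
          · rw [hx.2.1 h1.symm, ← h1, zero_add, zero_add]
            exact hy.2.2 (by simpa [← h1] using h)
          rcases hy.1.eq_or_lt with h2 | h2
          · rw [hy.2.1 h2.symm, ← h2, add_zero, add_zero]
            exact hx.2.2 h1
          have := (convex_convexHull ℚ (Q : Set V)) (hx.2.2 h1) (hy.2.2 h2)
            (a := x.2 / (x.2 + y.2)) (b := y.2 / (x.2 + y.2)) (by positivity) (by positivity)
            (by field_simp)
          convert this using 1
          rw [smul_smul, smul_smul, smul_add]
          congr 2 <;> field_simp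
      | smul a x _ hx =>
        rw [← Nonneg.coe_smul]
        refine ⟨mul_nonneg a.2 hx.1, fun h => ?_, fun h => ?_⟩
        · rcases mul_eq_zero.1 (show (a : ℚ) * x.2 = 0 from h) with h | h
          · rw [h, zero_smul]; rfl
          · rw [Prod.smul_fst, hx.2.1 h, smul_zero]
        · have h' : 0 < (a : ℚ) * x.2 := h
          have ha : (a : ℚ) ≠ 0 := by rintro h0; rw [h0, zero_mul] at h'; exact lt_irrefl _ h'
          have hx0 : 0 < x.2 := by
            rcases hx.1.eq_or_lt with h0 | h0
            · rw [← h0, mul_zero] at h'; exact absurd h' (lt_irrefl _)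
            · exact h0
          convert hx.2.2 hx0 using 1
          rw [Prod.smul_fst, Prod.smul_snd, smul_smul, smul_eq_mul]
          congr 1
          field_simp
    have e1 : y.1 + z.1 = v := congrArg Prod.fst hyz
    have e2 : z.2 = 1 := by have := congrArg Prod.snd hyz; simpa [hy2.1] using this
    refine hv ⟨y.1, hy2.2, z.1, ?_, e1⟩
    simpa [e2] using hz2.2.2 (by rw [e2]; exact one_pos)
  obtain ⟨L, hL, hLv⟩ := exists_dual_neg_of_notMem_hull
    ((s.finite_toSet.image _).union (Q.finite_toSet.image _)) hnot
  refine ⟨L.comp (LinearMap.inl ℚ V ℚ), -L (0, 1), fun x hx => ?_, fun q hq => ?_, ?_⟩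
  · refine nonneg_of_mem_hull (s := (s : Set V)) (fun y hy => ?_) hx
    simpa using hL _ (Or.inl ⟨y, hy, rfl⟩)
  · have := hL _ (Or.inr ⟨q, hq, rfl⟩)
    rw [dual_prod_apply, one_mul] at this
    linarith
  · rw [dual_prod_apply, one_mul] at hLv
    linarith

end Polyhedra

/-! ### Gauss valuations on `K[M]` -/

section GaussValuation

namespace AddMonoidAlgebra

variable {K M Γ₀ : Type*} [Field K] [AddCommGroup M]
  [LinearOrderedCommGroupWithZero Γ₀]

/-- The value of the Gauss valuation at `y = ∑ y_m χ^m` is the maximum of the `w y_m * φ m`. -/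
noncomputable def gaussFun (w : Valuation K Γ₀) (φ : Multiplicative M →* Γ₀)
    (y : AddMonoidAlgebra K M) : Γ₀ :=
  y.coeff.support.sup fun m => w (y.coeff m) * φ (.ofAdd m)

variable (w : Valuation K Γ₀) (φ : Multiplicative M →* Γ₀)

theorem gaussFun_le_iff (y : AddMonoidAlgebra K M) (c : Γ₀) :
    gaussFun w φ y ≤ c ↔ ∀ m, w (y.coeff m) * φ (.ofAdd m) ≤ c := by
  rw [gaussFun, Finset.sup_le_iff]
  refine forall_congr' fun m => ⟨fun h => ?_, fun h _ => h⟩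
  by_cases hm : y.coeff m = 0
  · rw [hm, map_zero, zero_mul]; exact zero_le
  · exact h (Finsupp.mem_support_iff.2 hm)

theorem le_gaussFun (y : AddMonoidAlgebra K M) (m : M) :
    w (y.coeff m) * φ (.ofAdd m) ≤ gaussFun w φ y :=
  (gaussFun_le_iff w φ y _).1 le_rfl m

theorem exists_eq_gaussFun {y : AddMonoidAlgebra K M} (hy : y ≠ 0) :
    ∃ m, y.coeff m ≠ 0 ∧ w (y.coeff m) * φ (.ofAdd m) = gaussFun w φ y := by
  have hne : y.coeff.support.Nonempty := by
    rw [Finsupp.support_nonempty_iff]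
    intro h
    exact hy (AddMonoidAlgebra.coeff_injective (by simpa using h))
  obtain ⟨m, hm, h⟩ := Finset.exists_mem_eq_sup _ hne fun m => w (y.coeff m) * φ (.ofAdd m)
  exact ⟨m, Finsupp.mem_support_iff.1 hm, h.symm⟩

theorem gaussFun_ne_zero {y : AddMonoidAlgebra K M} (hy : y ≠ 0) : gaussFun w φ y ≠ 0 := by
  obtain ⟨m, hm, h⟩ := exists_eq_gaussFun w φ hy
  rw [← h]
  exact mul_ne_zero ((Valuation.ne_zero_iff w).2 hm) ((Group.isUnit (Multiplicative.ofAdd m)).map φ).ne_zero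

theorem gaussFun_mul_le (x y : AddMonoidAlgebra K M) :
    gaussFun w φ (x * y) ≤ gaussFun w φ x * gaussFun w φ y := by
  classical
  rw [gaussFun_le_iff]
  intro m
  have hφ : φ (.ofAdd m) ≠ 0 := ((Group.isUnit (Multiplicative.ofAdd m)).map φ).ne_zero
  rw [← le_div_iff₀ (zero_lt_iff.2 hφ), coeff_mul]
  refine Valuation.map_sum_le _ fun a _ => Valuation.map_sum_le _ fun b _ => ?_
  dsimp only
  split_ifs with h
  · rw [le_div_iff₀ (zero_lt_iff.2 hφ), ← h, ofAdd_add, map_mul, map_mul, mul_mul_mul_comm]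
    exact mul_le_mul' (le_gaussFun w φ x a) (le_gaussFun w φ y b)
  · rw [map_zero]; exact zero_le

variable [UniqueSums M]

/-- Among the terms of maximal value in `x` and in `y`, unique sums provide a pair `(a, b)` whose
sum is reached only once. In the coefficient of degree `a + b` the product of these two terms
strictly dominates all others, so it cannot cancel. -/
theorem gaussFun_mul (x y : AddMonoidAlgebra K M) :
    gaussFun w φ (x * y) = gaussFun w φ x * gaussFun w φ y := by
  classical
  refine (gaussFun_mul_le w φ x y).antisymm ?_
  by_cases hx : x = 0
  · simp [hx, gaussFun, bot_eq_zero]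
  by_cases hy : y = 0
  · simp [hy, gaussFun, bot_eq_zero]
  set gx := gaussFun w φ x with hgx
  set gy := gaussFun w φ y with hgy
  have hgx0 : gx ≠ 0 := gaussFun_ne_zero w φ hx
  have hgy0 : gy ≠ 0 := gaussFun_ne_zero w φ hy
  let S := x.coeff.support.filter fun m => w (x.coeff m) * φ (.ofAdd m) = gx
  let T := y.coeff.support.filter fun m => w (y.coeff m) * φ (.ofAdd m) = gy
  have hS : S.Nonempty := by
    obtain ⟨m, hm, h⟩ := exists_eq_gaussFun w φ hx
    exact ⟨m, Finset.mem_filter.2 ⟨Finsupp.mem_support_iff.2 hm, h⟩⟩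
  have hT : T.Nonempty := by
    obtain ⟨m, hm, h⟩ := exists_eq_gaussFun w φ hy
    exact ⟨m, Finset.mem_filter.2 ⟨Finsupp.mem_support_iff.2 hm, h⟩⟩
  obtain ⟨a, ha, b, hb, hab⟩ := UniqueSums.uniqueAdd_of_nonempty hS hT
  obtain ⟨haS, haeq⟩ := Finset.mem_filter.1 ha
  obtain ⟨hbT, hbeq⟩ := Finset.mem_filter.1 hb
  have hφ0 : ∀ m, φ (.ofAdd m) ≠ 0 := fun m => ((Group.isUnit (Multiplicative.ofAdd m)).map φ).ne_zero
  have key : w ((x * y).coeff (a + b)) = w (x.coeff a * y.coeff b) := by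
    rw [coeff_mul, Finsupp.sum]
    simp only [Finsupp.sum]
    rw [← Finset.sum_product']
    let F : M × M → K := fun p => if p.1 + p.2 = a + b then x.coeff p.1 * y.coeff p.2 else 0
    change w (∑ p ∈ x.coeff.support ×ˢ y.coeff.support, F p) = _
    have hterm : F (a, b) = x.coeff a * y.coeff b := by simp [F]
    rw [← hterm]
    refine Valuation.map_sum_eq_of_lt _ (Finset.mem_product.2 ⟨haS, hbT⟩) ?_
    · rintro ⟨c, d⟩ hcd
      rw [hterm]
      obtain ⟨hcd, hne⟩ := Finset.mem_sdiff.1 hcd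
      obtain ⟨hc, hd⟩ := Finset.mem_product.1 hcd
      have hpos : 0 < w (x.coeff a * y.coeff b) := by
        rw [zero_lt_iff, Valuation.ne_zero_iff]
        exact mul_ne_zero (Finsupp.mem_support_iff.1 haS) (Finsupp.mem_support_iff.1 hbT)
      simp only [F]
      split_ifs with h
      · rw [← mul_lt_mul_iff_left₀ (zero_lt_iff.2 (hφ0 (a + b)))]
        have e1 : w (x.coeff a * y.coeff b) * φ (.ofAdd (a + b)) = gx * gy := by
          rw [ofAdd_add, map_mul, map_mul, mul_mul_mul_comm, haeq, hbeq]
        have e2 : w (x.coeff c * y.coeff d) * φ (.ofAdd (a + b)) =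
            (w (x.coeff c) * φ (.ofAdd c)) * (w (y.coeff d) * φ (.ofAdd d)) := by
          rw [← h, ofAdd_add, map_mul, map_mul, mul_mul_mul_comm]
        rw [e1, e2]
        have h1 := le_gaussFun w φ x c
        have h2 := le_gaussFun w φ y d
        rcases h1.lt_or_eq with h1 | h1
        · exact (mul_le_mul' le_rfl h2).trans_lt ((mul_lt_mul_iff_left₀ (zero_lt_iff.2 hgy0)).2 h1)
        rcases h2.lt_or_eq with h2' | h2'
        · rw [h1, ← hgx]
          exact (mul_lt_mul_iff_right₀ (zero_lt_iff.2 hgx0)).2 h2'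
        · exfalso
          have := hab (Finset.mem_filter.2 ⟨hc, h1⟩) (Finset.mem_filter.2 ⟨hd, h2'⟩) h
          exact hne (Finset.mem_singleton.2 (Prod.ext this.1 this.2))
      · rw [map_zero]; exact hpos
  calc gx * gy = w ((x * y).coeff (a + b)) * φ (.ofAdd (a + b)) := by
        rw [key, ofAdd_add, map_mul, map_mul, mul_mul_mul_comm, haeq, hbeq]
    _ ≤ _ := le_gaussFun w φ _ _

/-- The Gauss valuation on `K[M]` attached to a valuation `w` of `K` and a character `φ` of `M`. -/
noncomputable def gaussValuation : Valuation (AddMonoidAlgebra K M) Γ₀ where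
  toFun := gaussFun w φ
  map_zero' := by simp [gaussFun, bot_eq_zero]
  map_one' := by
    classical
    have h1 : (1 : AddMonoidAlgebra K M) ≠ 0 := one_ne_zero
    refine le_antisymm ?_ ?_
    · rw [gaussFun_le_iff]
      intro m
      rw [AddMonoidAlgebra.one_def, AddMonoidAlgebra.coeff_single, Finsupp.single_apply]
      split_ifs with h
      · rw [← h, ofAdd_zero, map_one, map_one, one_mul]
      · rw [map_zero, zero_mul]; exact zero_le
    · refine le_trans (le_of_eq ?_) (le_gaussFun w φ 1 0)
      rw [AddMonoidAlgebra.one_def, AddMonoidAlgebra.coeff_single, Finsupp.single_eq_same,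
        ofAdd_zero, map_one, map_one, one_mul]
  map_mul' := gaussFun_mul w φ
  map_add_le_max' x y := by
    rw [gaussFun_le_iff]
    intro m
    have hφ : 0 < φ (.ofAdd m) := zero_lt_iff.2 ((Group.isUnit (Multiplicative.ofAdd m)).map φ).ne_zero
    rw [← le_div_iff₀ hφ, AddMonoidAlgebra.coeff_add, Finsupp.add_apply]
    refine (w.map_add _ _).trans (max_le ?_ ?_)
    · rw [le_div_iff₀ hφ]
      exact (le_gaussFun w φ x m).trans (le_max_left _ _)
    · rw [le_div_iff₀ hφ]
      exact (le_gaussFun w φ y m).trans (le_max_right _ _)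

theorem mem_integer_gaussValuation_iff (y : AddMonoidAlgebra K M) :
    y ∈ (gaussValuation w φ).integer ↔ ∀ m, w (y.coeff m) * φ (.ofAdd m) ≤ 1 :=
  gaussFun_le_iff w φ y 1

end AddMonoidAlgebra

/-- The valuation with values in the additive group `ℚ` defined by an order function. -/
noncomputable def valuationOfOrder {K : Type*} [Field K] (ω : K → ℤ)
    (hmul : ∀ x y, x ≠ 0 → y ≠ 0 → ω (x * y) = ω x + ω y)
    (hadd : ∀ x y, x ≠ 0 → y ≠ 0 → x + y ≠ 0 → min (ω x) (ω y) ≤ ω (x + y)) :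
    Valuation K (WithZero (Multiplicative ℚ)) where
  -- The sign passes from an order function to a multiplicative valuation. Rational exponents leave
  -- room for the weights `μ(v)` with `v` a rational point.
  toFun x := open scoped Classical in if x = 0 then 0 else WithZero.exp (-(ω x : ℚ))
  map_zero' := by simp
  map_one' := by
    have := hmul 1 1 one_ne_zero one_ne_zero
    rw [one_mul] at this
    have h0 : ω 1 = 0 := by omega
    simp [h0]
  map_mul' x y := by
    by_cases hx : x = 0
    · simp [hx]
    by_cases hy : y = 0
    · simp [hy]
    simp only [mul_eq_zero, hx, hy, or_self, if_false, hmul x y hx hy, ← WithZero.exp_add]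
    congr 1
    push_cast
    ring
  map_add_le_max' x y := by
    by_cases hx : x = 0
    · rw [hx, zero_add]; exact le_max_right _ _
    by_cases hy : y = 0
    · rw [hy, add_zero]; exact le_max_left _ _
    by_cases hxy : x + y = 0
    · simp [hxy]
    simp only [hx, hy, hxy, if_false]
    rcases min_le_iff.1 (hadd x y hx hy hxy) with h | h
    · exact le_max_of_le_left (WithZero.exp_le_exp.2 (neg_le_neg (by exact_mod_cast h)))
    · exact le_max_of_le_right (WithZero.exp_le_exp.2 (neg_le_neg (by exact_mod_cast h)))

/-- The lower bounds `0 ≤ ω y_m + φ m` for the coefficients `y_m` pass from a subring of `K[M]`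
to its integral closure in `K[M]`. -/
theorem coeff_bound_of_isIntegral {K M : Type*} [Field K] [AddCommGroup M] [UniqueSums M]
    (ω : K → ℤ) (hmul : ∀ x y, x ≠ 0 → y ≠ 0 → ω (x * y) = ω x + ω y)
    (hadd : ∀ x y, x ≠ 0 → y ≠ 0 → x + y ≠ 0 → min (ω x) (ω y) ≤ ω (x + y)) (φ : M →+ ℚ)
    {R : Type*} [CommRing R] [Algebra R (AddMonoidAlgebra K M)] (G : Set (AddMonoidAlgebra K M))
    (hR : ∀ x m, (algebraMap R (AddMonoidAlgebra K M) x).coeff m ≠ 0 →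
      0 ≤ (ω ((algebraMap R (AddMonoidAlgebra K M) x).coeff m) : ℚ) + φ m)
    (hG : ∀ x ∈ G, ∀ m, x.coeff m ≠ 0 → 0 ≤ (ω (x.coeff m) : ℚ) + φ m)
    {y : AddMonoidAlgebra K M} (hy : IsIntegral (Algebra.adjoin R G) y) (m : M)
    (hm : y.coeff m ≠ 0) : 0 ≤ (ω (y.coeff m) : ℚ) + φ m := by
  let ψ : Multiplicative M →* WithZero (Multiplicative ℚ) :=
    { toFun m := WithZero.exp (-φ m.toAdd)
      map_one' := by simp
      map_mul' a b := by rw [← WithZero.exp_add, toAdd_mul, map_add, neg_add] }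
  -- The bounds say exactly that an element lies in the ring of integers of this valuation, which is
  -- closed under sums and products and contains all elements integral over it.
  set V := AddMonoidAlgebra.gaussValuation (valuationOfOrder ω hmul hadd) ψ with hV
  have hiff : ∀ x : AddMonoidAlgebra K M, x ∈ V.integer ↔
      ∀ m, x.coeff m ≠ 0 → 0 ≤ (ω (x.coeff m) : ℚ) + φ m := by
    intro x
    rw [hV, AddMonoidAlgebra.mem_integer_gaussValuation_iff]
    refine forall_congr' fun m => ?_
    by_cases h : x.coeff m = 0
    · simp [h]
    · have e : valuationOfOrder ω hmul hadd (x.coeff m) = WithZero.exp (-(ω (x.coeff m) : ℚ)) :=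
        if_neg h
      rw [e]
      simp only [ne_eq, h, not_false_eq_true, forall_const]
      change WithZero.exp _ * WithZero.exp (-φ m) ≤ 1 ↔ _
      rw [← WithZero.exp_add, ← WithZero.exp_zero, WithZero.exp_le_exp]
      constructor <;> intro h <;> linarith
  have hle : ∀ a ∈ Algebra.adjoin R G, a ∈ V.integer := by
    intro a ha
    induction ha using Algebra.adjoin_induction with
    | mem x hx => exact (hiff x).2 (hG x hx)
    | algebraMap r => exact (hiff _).2 (hR r)
    | add x y _ _ hx hy => exact add_mem hx hy
    | mul x y _ _ hx hy => exact mul_mem hx hy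
  refine (hiff y).1 ?_ m hm
  refine (Valuation.integer.integers V).mem_of_integral ?_
  obtain ⟨p, hp, hpy⟩ := hy
  refine ⟨p.map ((Algebra.adjoin R G).toSubring.subtype.codRestrict V.integer
    fun a => hle _ a.2), hp.map _, ?_⟩
  rw [Polynomial.eval₂_map]
  exact hpy

end GaussValuation

/-! ### `K[M]` is integrally closed -/

section IntegrallyClosed

/-- The group algebra of a free abelian group of finite rank over a field is integrally closed. -/
theorem AddMonoidAlgebra.isIntegrallyClosed_of_free {K M : Type*} [Field K] [AddCommGroup M]
    [Module.Free ℤ M] [Module.Finite ℤ M] : IsIntegrallyClosed (AddMonoidAlgebra K M) := by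
  classical
  let b := Module.finBasis ℤ M
  let e : (Fin (Module.finrank ℤ M) →₀ ℕ) →+ M :=
    { toFun s := ∑ i, s i • b i
      map_zero' := by simp
      map_add' s t := by simp [add_smul, Finset.sum_add_distrib] }
  have he_repr : ∀ s i, b.repr (e s) i = s i := by
    intro s i
    have : e s = ∑ i, (s i : ℤ) • b i := by simp [e]
    rw [this, b.repr_sum_self]
  have he : Function.Injective e := fun s t h => by
    ext i
    have h1 := he_repr s i
    rw [h, he_repr] at h1
    exact_mod_cast h1.symm
  let P := MvPolynomial (Fin (Module.finrank ℤ M)) K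
  let g : P →+* AddMonoidAlgebra K M := AddMonoidAlgebra.mapDomainRingHom K e
  have hg : Function.Injective g := AddMonoidAlgebra.mapDomain_injective he
  have hgs : ∀ s c, g (AddMonoidAlgebra.single s c) = AddMonoidAlgebra.single (e s) c := fun s c =>
    AddMonoidAlgebra.mapDomain_single
  let _ : Algebra P (AddMonoidAlgebra K M) := g.toAlgebra
  -- Laurent polynomials are the polynomial ring localized at its monomials, and integral closedness
  -- passes to localizations.
  let S : Submonoid P := Submonoid.map (AddMonoidAlgebra.of K (Fin (Module.finrank ℤ M) →₀ ℕ)) ⊤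
  have hS : S ≤ nonZeroDivisors P := by
    rintro _ ⟨s, -, rfl⟩
    rw [mem_nonZeroDivisors_iff_ne_zero]
    exact AddMonoidAlgebra.single_ne_zero.2 one_ne_zero
  have hloc : IsLocalization S (AddMonoidAlgebra K M) := by
    refine (isLocalization_iff S _).2 ⟨?_, ?_, ?_⟩
    · rintro ⟨_, s, -, rfl⟩
      refine IsUnit.of_mul_eq_one (AddMonoidAlgebra.single (-e s.toAdd) 1) ?_
      change g (AddMonoidAlgebra.single s.toAdd 1) * _ = 1
      rw [hgs, AddMonoidAlgebra.single_mul_single, add_neg_cancel, one_mul]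
      rfl
    · suffices h : ∀ z : AddMonoidAlgebra K M, ∃ s p, z * AddMonoidAlgebra.single (e s) 1 = g p by
        intro z
        obtain ⟨s, p, h⟩ := h z
        refine ⟨(p, ⟨_, ⟨.ofAdd s, trivial, rfl⟩⟩), ?_⟩
        change z * g (AddMonoidAlgebra.single s 1) = g p
        rw [hgs, h]
      intro z
      induction z using AddMonoidAlgebra.induction_linear with
      | zero => exact ⟨0, 0, by simp⟩
      | add x y hx hy =>
        obtain ⟨s, p, hp⟩ := hx
        obtain ⟨t, q, hq⟩ := hy
        refine ⟨s + t, p * AddMonoidAlgebra.single t 1 + q * AddMonoidAlgebra.single s 1, ?_⟩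
        have hst : (AddMonoidAlgebra.single (e (s + t)) 1 : AddMonoidAlgebra K M) =
            AddMonoidAlgebra.single (e s) 1 * AddMonoidAlgebra.single (e t) 1 := by
          rw [AddMonoidAlgebra.single_mul_single, map_add, one_mul]
        rw [map_add g, map_mul g, map_mul g, hgs, hgs, ← hp, ← hq, hst]
        ring
      | single m c =>
        refine ⟨Finsupp.equivFunOnFinite.symm fun i => (-(b.repr m i)).toNat,
          AddMonoidAlgebra.single (Finsupp.equivFunOnFinite.symm fun i => (b.repr m i).toNat) c, ?_⟩
        rw [hgs, AddMonoidAlgebra.single_mul_single, mul_one]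
        congr 1
        refine b.ext_elem fun i => ?_
        rw [map_add, Finsupp.add_apply, he_repr, he_repr]
        simp only [Finsupp.equivFunOnFinite_symm_apply_apply]
        omega
    · intro x y hxy
      exact ⟨1, by rw [hg hxy]⟩
  exact isIntegrallyClosed_of_isLocalization (AddMonoidAlgebra K M) S hS

end IntegrallyClosed

theorem uniqueSums_of_free (M : Type*) [AddCommGroup M] [Module.Free ℤ M] : UniqueSums M :=
  UniqueSums.of_injective_addHom (Module.Free.chooseBasis ℤ M).repr.toAddEquiv.toAddMonoidHom.toAddHom
    (Module.Free.chooseBasis ℤ M).repr.injective inferInstance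

instance {N : Type*} [AddCommGroup N] [Module.Free ℤ N] [Module.Finite ℤ N] : UniqueSums (LatM N) :=
  uniqueSums_of_free _


/-! ### Functions with a single pole -/

section FunctionField

open IntermediateField
open scoped IntermediateField.algebraAdjoinAdjoin

variable {k K : Type*} [Field k] [Field K] [Algebra k K]

/-- The `k`-subalgebra underlying a valuation subring that contains `k`. -/
def ValuationSubring.toSubalgebraOfLE (O : ValuationSubring K) (hO : ∀ c : k, algebraMap k K c ∈ O) :
    Subalgebra k K :=
  { O.toSubring with algebraMap_mem' := hO }

theorem ValuationSubring.mem_of_isIntegral_subalgebra (O : ValuationSubring K) {A : Subalgebra k K}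
    (hA : ∀ a ∈ A, a ∈ O) {x : K} (hx : IsIntegral A x) : x ∈ O := by
  have hx' : IsIntegral O x := by
    obtain ⟨p, hp, hpx⟩ := hx
    refine ⟨p.map (A.toSubring.subtype.codRestrict O.toSubring fun a => hA _ a.2), hp.map _, ?_⟩
    rw [Polynomial.eval₂_map]
    exact hpx
  obtain ⟨y, rfl⟩ := IsIntegrallyClosed.isIntegral_iff.1 hx'
  exact y.2

theorem ValuationSubring.mul_mem_nonunits (O : ValuationSubring K) {x y : K} (hx : x ∈ O)
    (hy : y ∈ O.nonunits) : x * y ∈ O.nonunits := by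
  rw [O.mem_nonunits_iff] at hy ⊢
  rw [map_mul]
  exact (mul_le_of_le_one_left' ((O.valuation_le_one_iff x).2 hx)).trans_lt hy

-- After division by the leading coefficient, `y` is a root of `p - p(y)`; as `p` is not constant,
-- subtracting the constant `p(y)` keeps it monic.
open Polynomial in
theorem isIntegral_of_aeval_mem (B : Subalgebra k K) {p : k[X]} (hp : 0 < p.natDegree) {y : K}
    (hy : aeval y p ∈ B) : IsIntegral B y := by
  have hp0 : p ≠ 0 := by rintro rfl; simp at hp
  have hmonic : (C p.leadingCoeff⁻¹ * p).Monic := by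
    rw [mul_comm]; exact monic_mul_leadingCoeff_inv hp0
  have hdeg : 0 < (C p.leadingCoeff⁻¹ * p).degree := by
    rw [degree_C_mul (inv_ne_zero (leadingCoeff_ne_zero.2 hp0))]
    exact natDegree_pos_iff_degree_pos.1 hp
  let z : B := ⟨p.leadingCoeff⁻¹ • aeval y p, B.smul_mem hy _⟩
  refine ⟨(C p.leadingCoeff⁻¹ * p).map (algebraMap k B) - C z, ?_, ?_⟩
  · refine (hmonic.map _).sub_of_left ?_
    rw [degree_map]
    exact degree_C_le.trans_lt hdeg
  · rw [eval₂_sub, eval₂_map, eval₂_C, ← IsScalarTower.algebraMap_eq]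
    change aeval y _ - p.leadingCoeff⁻¹ • aeval y p = 0
    rw [map_mul, aeval_C, Algebra.smul_def, sub_self]

/-- A function integral over `k[t]` becomes integral over `k[t⁻¹]` after division by a power
of `t`. -/
theorem exists_mul_inv_pow_isIntegral {t : K} (ht : t ≠ 0) {e : K}
    (he : IsIntegral (Algebra.adjoin k {t}) e) :
    ∃ d : ℕ, ∀ n ≥ d, IsIntegral (Algebra.adjoin k {t⁻¹}) (e * t⁻¹ ^ n) := by
  set A := Algebra.adjoin k {t}
  set A' := Algebra.adjoin k {t⁻¹} with hA'
  have htA' : t⁻¹ ∈ A' := Algebra.self_mem_adjoin_singleton k _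
  have hmem : ∀ a ∈ A, ∃ d : ℕ, ∀ n ≥ d, a * t⁻¹ ^ n ∈ A' := by
    intro a ha
    suffices h : ∃ d : ℕ, a * t⁻¹ ^ d ∈ A' by
      obtain ⟨d, hd⟩ := h
      refine ⟨d, fun n hn => ?_⟩
      rw [← Nat.add_sub_cancel' hn, pow_add, ← mul_assoc]
      exact mul_mem hd (pow_mem htA' _)
    induction ha using Algebra.adjoin_induction with
    | mem x hx =>
      rw [Set.mem_singleton_iff.1 hx]
      exact ⟨1, by simp [mul_inv_cancel₀ ht, one_mem]⟩
    | algebraMap r => exact ⟨0, by simp⟩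
    | add x y _ _ hx hy =>
      obtain ⟨c, hc⟩ := hx
      obtain ⟨d, hd⟩ := hy
      refine ⟨c + d, ?_⟩
      rw [pow_add, add_mul]
      refine add_mem ?_ ?_
      · rw [← mul_assoc]; exact mul_mem hc (pow_mem htA' _)
      · rw [mul_comm (t⁻¹ ^ c), ← mul_assoc]; exact mul_mem hd (pow_mem htA' _)
    | mul x y _ _ hx hy =>
      obtain ⟨c, hc⟩ := hx
      obtain ⟨d, hd⟩ := hy
      exact ⟨c + d, by rw [pow_add, mul_mul_mul_comm]; exact mul_mem hc hd⟩
  obtain ⟨p, hp, hpe⟩ := he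
  choose! D hD using hmem
  obtain ⟨d, hd⟩ : ∃ d : ℕ, ∀ i ∈ Finset.range p.natDegree, D (p.coeff i : K) ≤ d :=
    ⟨(Finset.range p.natDegree).sup fun i => D (p.coeff i : K),
      fun i hi => Finset.le_sup (f := fun i => D (p.coeff i : K)) hi⟩
  refine ⟨d, fun n hn => ?_⟩
  -- The coefficient of degree `i` gets multiplied by `t⁻¹ ^ (n * (deg p - i))`. For `i < deg p` the
  -- exponent is at least `n ≥ d`, enough to bring it into `k[t⁻¹]`.
  let q : Polynomial K := (p.map A.toSubring.subtype).scaleRoots (t⁻¹ ^ n)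
  have hpm : (p.map A.toSubring.subtype).Monic := hp.map _
  have hpn : (p.map A.toSubring.subtype).natDegree = p.natDegree := hp.natDegree_map _
  have hq : q.Monic := (Polynomial.monic_scaleRoots_iff _).2 hpm
  have hqc : ∀ i, q.coeff i ∈ A'.toSubring := by
    intro i
    rw [Polynomial.coeff_scaleRoots, hpn, Polynomial.coeff_map]
    rcases lt_trichotomy i p.natDegree with hi | hi | hi
    · rw [← pow_mul]
      refine hD _ (p.coeff i).2 _ ((hd i (Finset.mem_range.2 hi)).trans (hn.trans ?_))
      exact Nat.le_mul_of_pos_right n (Nat.sub_pos_of_lt hi)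
    · rw [hi, hp.coeff_natDegree, Nat.sub_self, pow_zero, map_one, one_mul]
      exact one_mem _
    · rw [Polynomial.coeff_eq_zero_of_natDegree_lt hi, map_zero, zero_mul]
      exact zero_mem _
  have hqs : (q.coeffs : Set K) ⊆ A'.toSubring := fun x hx => by
    obtain ⟨i, -, rfl⟩ := Polynomial.mem_coeffs_iff.1 hx
    exact hqc i
  refine ⟨q.toSubring A'.toSubring hqs, (Polynomial.monic_toSubring _ _ _).2 hq, ?_⟩
  have h1 : q.eval (e * t⁻¹ ^ n) = 0 := by
    rw [mul_comm]
    have := Polynomial.scaleRoots_eval₂_eq_zero (p := p.map A.toSubring.subtype) (RingHom.id K)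
      (r := e) (s := t⁻¹ ^ n) (by rw [Polynomial.eval₂_map]; exact hpe)
    exact this
  have h2 : (q.toSubring A'.toSubring hqs).map A'.toSubring.subtype = q := Polynomial.map_toSubring _ _ _
  rw [← h2, Polynomial.eval_map] at h1
  exact h1

/-- In a function field of one variable, the valuation ring of a place `W` is the only one
(up to inclusion) that misses a suitable function. -/
theorem exists_function_with_single_pole [CharZero k] {t : K} (ht : Transcendental k t)
    [FiniteDimensional k⟮t⟯ K] (W : ValuationSubring K) (hW : ∀ c : k, algebraMap k K c ∈ W)
    (htW : t⁻¹ ∉ W) :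
    ∃ u, u ∉ W ∧ ∀ O : ValuationSubring K, (∀ c : k, algebraMap k K c ∈ O) → u ∉ O → O ≤ W := by
  classical
  have ht0 : t ≠ 0 := by rintro rfl; exact htW (by simp)
  have htW' : t ∈ W := (W.mem_or_inv_mem t).resolve_right htW
  set A := Algebra.adjoin k {t} with hA
  have htA : t ∈ A := Algebra.self_mem_adjoin_singleton k _
  have hsurj : Function.Surjective (((Polynomial.aeval t).codRestrict A fun p => by
      rw [hA, Algebra.adjoin_singleton_eq_range_aeval]; exact ⟨p, rfl⟩) : Polynomial k →ₐ[k] A) := by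
    rintro ⟨a, ha⟩
    rw [hA, Algebra.adjoin_singleton_eq_range_aeval] at ha
    obtain ⟨p, rfl⟩ := ha
    exact ⟨p, rfl⟩
  have hpid : IsPrincipalIdealRing A := IsPrincipalIdealRing.of_surjective _ hsurj
  have hfrac : IsFractionRing A k⟮t⟯ := inferInstance
  have hsep : Algebra.IsSeparable k⟮t⟯ K := inferInstance
  set R := integralClosure A K with hR
  have hfin : Module.Finite A R := IsIntegralClosure.finite A k⟮t⟯ K R
  have hded : IsDedekindDomain R := integralClosure.isDedekindDomain A k⟮t⟯ K
  have hRfrac : IsFractionRing R K := IsIntegralClosure.isFractionRing_of_finite_extension A k⟮t⟯ K R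
  have hAO : ∀ O : ValuationSubring K, (∀ c : k, algebraMap k K c ∈ O) → t ∈ O → ∀ a ∈ R, a ∈ O := by
    intro O hO htO a ha
    refine O.mem_of_isIntegral_subalgebra (A := A) (fun b hb => ?_) ha
    have : A ≤ O.toSubalgebraOfLE hO := Algebra.adjoin_le (Set.singleton_subset_iff.2 htO)
    exact this hb
  have hRW := hAO W hW htW'
  have htR : t ∈ R := algebraMap_mem R (⟨t, htA⟩ : A)
  -- the centre of `W` on `R`
  let P : Ideal R := (IsLocalRing.maximalIdeal W).comap
    (R.toSubring.subtype.codRestrict W.toSubring fun a => hRW _ a.2)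
  have hPprime : P.IsPrime := Ideal.comap_isPrime _ _
  have hPmem : ∀ a : R, a ∈ P ↔ (a : K) ∈ W.nonunits := by
    intro a
    rw [ValuationSubring.mem_nonunits_iff_exists_mem_maximalIdeal]
    exact ⟨fun h => ⟨hRW _ a.2, h⟩, fun ⟨_, h⟩ => h⟩
  have htP : (⟨t, htR⟩ : R) ∈ P := (hPmem _).2 (W.mem_nonunits_iff_or.2 (Or.inr htW))
  have hP0 : P ≠ ⊥ := fun h => by
    rw [h, Ideal.mem_bot] at htP
    exact ht0 (congrArg Subtype.val htP)
  have hPmax : P.IsMaximal := hPprime.isMaximal hP0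
  -- An element of `P⁻¹` outside `R` has a pole at `P`, and no other pole on `Spec R`; its behaviour
  -- at the places over `t = ∞` is corrected below.
  obtain ⟨y, hyP, hyR⟩ := FractionalIdeal.exists_notMem_one_of_ne_bot (K := K) hP0 hPprime.ne_top
  replace hyP : ∀ a ∈ P, y * (a : K) ∈ R := by
    intro a ha
    rw [FractionalIdeal.mem_inv_iff (FractionalIdeal.coeIdeal_ne_zero.2 hP0)] at hyP
    have := hyP a ((FractionalIdeal.mem_coeIdeal _).2 ⟨a, ha, rfl⟩)
    obtain ⟨b, hb⟩ := (FractionalIdeal.mem_one_iff _).1 this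
    rw [← hb]
    exact b.2
  replace hyR : y ∉ R := fun h => hyR ((FractionalIdeal.mem_one_iff _).2 ⟨⟨y, h⟩, rfl⟩)
  have hyint : ¬ IsIntegral R y := fun h => hyR (by
    obtain ⟨b, hb⟩ := IsIntegrallyClosed.isIntegral_iff.1 h
    rw [← hb]
    exact b.2)
  -- every nonzero element of `R` is a power of `y⁻¹` up to functions invertible at `P`
  have hpow : ∀ b ∈ R, b ≠ 0 → ∃ n : ℕ, ∃ h : y ^ n * b ∈ R, (⟨_, h⟩ : R) ∉ P := by
    intro b hb hb0
    by_contra hcon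
    push Not at hcon
    have hall : ∀ n : ℕ, y ^ n * b ∈ R := by
      intro n
      induction n with
      | zero => simpa using hb
      | succ n ih =>
        have := hyP _ (hcon n ih)
        rwa [← mul_assoc, ← pow_succ'] at this
    -- If all `y ^ n * b` lay in the Noetherian ring `R`, they would span a finitely generated
    -- module stable under `y`, making `y` integral over `R`.
    refine hyint ?_
    let Nm : Submodule R K := Submodule.span R (Set.range fun n : ℕ => y ^ n * b)
    refine isIntegral_of_smul_mem_submodule Nm ?_ ?_ y ?_
    · rw [Submodule.ne_bot_iff]
      exact ⟨b, Submodule.subset_span ⟨0, by simp⟩, hb0⟩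
    · have hle : Nm ≤ LinearMap.range (Algebra.linearMap R K) := by
        rw [Submodule.span_le]
        rintro _ ⟨n, rfl⟩
        exact ⟨⟨_, hall n⟩, rfl⟩
      have : IsNoetherian R (LinearMap.range (Algebra.linearMap R K)) := inferInstance
      have h2 : (Nm.comap (LinearMap.range (Algebra.linearMap R K)).subtype).FG := IsNoetherian.noetherian _
      have h3 := h2.map (LinearMap.range (Algebra.linearMap R K)).subtype
      rwa [Submodule.map_comap_subtype, inf_eq_right.2 hle] at h3
    · intro x hx
      induction hx using Submodule.span_induction with
      | mem x h =>
        obtain ⟨n, rfl⟩ := h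
        exact Submodule.subset_span ⟨n + 1, by simp [pow_succ', mul_assoc]⟩
      | zero => simp
      | add x z _ _ hx hz => rw [smul_add]; exact Nm.add_mem hx hz
      | smul a x _ hx => rw [smul_comm]; exact Nm.smul_mem _ hx
  have hyW : y ∉ W := fun hyW => by
    obtain ⟨n, h, hn⟩ := hpow t htR ht0
    exact hn ((hPmem _).2 (W.mul_mem_nonunits (pow_mem hyW n) ((hPmem _).1 htP)))
  -- a function with poles at `P` only
  obtain ⟨u, p, hp, hpu, hu⟩ : ∃ (u : K) (p : Polynomial k), 0 < p.natDegree ∧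
      Polynomial.aeval y p - u ∈ R ∧ IsIntegral (Algebra.adjoin k {t⁻¹}) u := by
    obtain ⟨S, hS⟩ := hfin.fg_top
    have hd : ∃ d : ℕ, ∀ e ∈ S, ∀ n ≥ d, IsIntegral (Algebra.adjoin k {t⁻¹}) ((e : K) * t⁻¹ ^ n) := by
      choose D hD using fun e : R => exists_mul_inv_pow_isIntegral (k := k) ht0 e.2
      exact ⟨S.sup D, fun e he n hn => hD e n ((Finset.le_sup he).trans hn)⟩
    obtain ⟨d, hd⟩ := hd
    -- The integral closures of `k[t]` and `k[t⁻¹]` are two affine charts of the complete curve. The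
    -- functions on their overlap, `a * t⁻¹ ^ n` with `a` in `R`, lie in the sum of the two rings up
    -- to the finite-dimensional `G`: this is finiteness of `H¹` of the structure sheaf.
    let R' : Submodule k K := (R.restrictScalars k).toSubmodule
    let I' : Submodule k K :=
      ((integralClosure (Algebra.adjoin k {t⁻¹}) K).restrictScalars k).toSubmodule
    let G : Submodule k K :=
      Submodule.span k ((fun q : R × ℕ => (q.1 : K) * t⁻¹ ^ q.2) '' (S ×ˢ Finset.range d : Finset (R × ℕ)))
    have hGfin : FiniteDimensional k G :=
      FiniteDimensional.span_of_finite k ((Finset.finite_toSet _).image _)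
    have hcover : ∀ a : R, ∀ n : ℕ, (a : K) * t⁻¹ ^ n ∈ R' ⊔ I' ⊔ G := by
      intro a
      have ha : a ∈ Submodule.span A (S : Set R) := hS ▸ Submodule.mem_top
      induction ha using Submodule.span_induction with
      | mem e he =>
        intro n
        rcases lt_or_ge n d with hn | hn
        · exact Submodule.mem_sup_right (Submodule.subset_span
            ⟨(e, n), Finset.mem_coe.2 (Finset.mem_product.2 ⟨he, Finset.mem_range.2 hn⟩), rfl⟩)
        · exact Submodule.mem_sup_left (Submodule.mem_sup_right (hd e he n hn))
      | zero => intro n; simp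
      | add a b _ _ ha hb => intro n; rw [Subalgebra.coe_add, add_mul]; exact add_mem (ha n) (hb n)
      | smul c a _ ha =>
        obtain ⟨c, hc⟩ := c
        change ∀ n : ℕ, (c * (a : K)) * t⁻¹ ^ n ∈ _
        suffices h : ∀ x ∈ R', (∀ n : ℕ, x * t⁻¹ ^ n ∈ R' ⊔ I' ⊔ G) →
            c * x ∈ R' ∧ ∀ n : ℕ, (c * x) * t⁻¹ ^ n ∈ R' ⊔ I' ⊔ G from (h a a.2 ha).2
        induction hc using Algebra.adjoin_induction with
        | mem x hx =>
          rw [Set.mem_singleton_iff.1 hx]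
          intro x hx hxn
          refine ⟨mul_mem (S := Subalgebra A K) (s := R) htR hx, fun n => ?_⟩
          cases n with
          | zero =>
            rw [pow_zero, mul_one]
            exact Submodule.mem_sup_left (Submodule.mem_sup_left
              (mul_mem (S := Subalgebra A K) (s := R) htR hx))
          | succ n =>
            convert hxn n using 1
            rw [pow_succ]
            field_simp
        | algebraMap r =>
          intro x hx hxn
          rw [← Algebra.smul_def]
          refine ⟨R'.smul_mem r hx, fun n => ?_⟩
          rw [smul_mul_assoc]
          exact Submodule.smul_mem _ _ (hxn n)
        | add c e _ _ hc he =>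
          intro x hx hxn
          rw [add_mul]
          refine ⟨add_mem (hc x hx hxn).1 (he x hx hxn).1, fun n => ?_⟩
          rw [add_mul]
          exact add_mem ((hc x hx hxn).2 n) ((he x hx hxn).2 n)
        | mul c e _ _ hc he =>
          intro x hx hxn
          rw [mul_assoc]
          exact hc _ (he x hx hxn).1 (he x hx hxn).2
    have hyt : y * t ∈ R := hyP _ htP
    have hyn : ∀ n : ℕ, y ^ n ∈ R' ⊔ I' ⊔ G := by
      intro n
      convert hcover ⟨_, pow_mem hyt n⟩ n using 1
      change y ^ n = (y * t) ^ n * _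
      rw [← mul_pow, mul_assoc, mul_inv_cancel₀ ht0, mul_one]
    have hpol : ∀ p : Polynomial k, Polynomial.aeval y p ∈ R' ⊔ I' ⊔ G := by
      intro p
      rw [Polynomial.aeval_eq_sum_range]
      exact Submodule.sum_mem _ fun i _ => Submodule.smul_mem _ _ (hyn i)
    -- The image is finite-dimensional and `k[X]` is not, so some polynomial in `y` splits as an
    -- element of `R` plus a function `u` integral over `k[t⁻¹]`. The factor `X` makes this
    -- polynomial nonconstant.
    let T : Polynomial k →ₗ[k] K ⧸ (R' ⊔ I') :=
      (R' ⊔ I').mkQ ∘ₗ (Polynomial.aeval y).toLinearMap ∘ₗ LinearMap.mulLeft k Polynomial.X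
    have hT : ∀ p, T p ∈ G.map (R' ⊔ I').mkQ := by
      intro p
      obtain ⟨x, hx, g, hg, hxg⟩ := Submodule.mem_sup.1 (hpol (Polynomial.X * p))
      refine ⟨g, hg, ?_⟩
      change _ = (R' ⊔ I').mkQ (Polynomial.aeval y (Polynomial.X * p))
      rw [← hxg, map_add, (Submodule.Quotient.mk_eq_zero _).2 hx |> (id : _ → (R' ⊔ I').mkQ x = 0), zero_add]
    have hTinj : ¬ Function.Injective T := fun hinj => by
      have : Module.Finite k (Polynomial k) :=
        Module.Finite.of_injective (T.codRestrict (G.map (R' ⊔ I').mkQ) hT)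
          fun a b hab => hinj (congrArg Subtype.val hab)
      exact Polynomial.not_finite this
    rw [injective_iff_map_eq_zero] at hTinj
    push Not at hTinj
    obtain ⟨p, hp0, hpne⟩ := hTinj
    have hmem : Polynomial.aeval y (Polynomial.X * p) ∈ R' ⊔ I' :=
      (Submodule.Quotient.mk_eq_zero _).1 hp0
    obtain ⟨x, hx, u, hu, hxu⟩ := Submodule.mem_sup.1 hmem
    refine ⟨u, Polynomial.X * p, ?_, ?_, hu⟩
    · rw [Polynomial.natDegree_X_mul hpne]
      exact Nat.succ_pos _
    · rw [← hxu, add_sub_cancel_right]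
      exact hx
  have hyO : ∀ O : ValuationSubring K, (∀ c : k, algebraMap k K c ∈ O) → (∀ a ∈ R, a ∈ O) →
      u ∈ O → y ∈ O := by
    intro O hO hRO huO
    refine O.mem_of_isIntegral_subalgebra (A := O.toSubalgebraOfLE hO) (fun a ha => ha)
      (isIntegral_of_aeval_mem _ hp ?_)
    have := O.add_mem _ _ (hRO _ hpu) huO
    rwa [sub_add_cancel] at this
  refine ⟨u, fun huW => hyW (hyO W hW hRW huW), fun O hO huO => ?_⟩
  -- A ring `O` that misses `u` must miss `t⁻¹`, hence contain `R`, hence miss `y`. Writing `a = (y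
  -- a) y⁻¹` for `a ∈ P` shows that its centre on `R` is again `P`.
  have htO : t⁻¹ ∉ O := fun htO => huO <| O.mem_of_isIntegral_subalgebra (fun a ha =>
    (Algebra.adjoin_le (S := O.toSubalgebraOfLE hO) (Set.singleton_subset_iff.2 htO)) ha) hu
  have hRO := hAO O hO ((O.mem_or_inv_mem t).resolve_right htO)
  have hyO' : y⁻¹ ∈ O.nonunits := by
    rw [O.inv_mem_nonunits_iff]
    right
    intro hyO''
    refine huO ?_
    have h1 : Polynomial.aeval y p ∈ O.toSubalgebraOfLE hO :=
      (Algebra.adjoin_le (Set.singleton_subset_iff.2 hyO'') : Algebra.adjoin k {y} ≤ O.toSubalgebraOfLE hO)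
        (Polynomial.aeval_mem_adjoin_singleton _ _)
    have := O.sub_mem h1 (hRO _ hpu)
    rwa [sub_sub_cancel] at this
  have hy0 : y ≠ 0 := by rintro rfl; exact hyW W.zero_mem
  let Q : Ideal R := (IsLocalRing.maximalIdeal O).comap
    (R.toSubring.subtype.codRestrict O.toSubring fun a => hRO _ a.2)
  have hQmem : ∀ a : R, a ∈ Q ↔ (a : K) ∈ O.nonunits := by
    intro a
    rw [ValuationSubring.mem_nonunits_iff_exists_mem_maximalIdeal]
    exact ⟨fun h => ⟨hRO _ a.2, h⟩, fun ⟨_, h⟩ => h⟩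
  have hPQ : P = Q := by
    refine hPmax.eq_of_le (Ideal.comap_isPrime _ _).ne_top fun a ha => (hQmem a).2 ?_
    have := O.mul_mem_nonunits (hRO _ (hyP a ha)) hyO'
    rwa [mul_comm y, mul_assoc, mul_inv_cancel₀ hy0, mul_one] at this
  rw [← ValuationSubring.nonunits_le_nonunits]
  intro w hw
  by_cases hw0 : w = 0
  · exact O.mem_nonunits_iff_or.2 (Or.inl hw0)
  obtain ⟨a, b, hb, rfl⟩ := IsFractionRing.div_surjective (A := R) w
  have hb0 : (b : K) ≠ 0 := fun h => nonZeroDivisors.ne_zero hb (Subtype.ext h)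
  have ha0 : (a : K) ≠ 0 := by rintro h; exact hw0 (by change (a : K) / b = 0; rw [h, zero_div])
  change (a : K) / b ∈ _ at hw
  change (a : K) / b ∈ _
  obtain ⟨m, hm, hmP⟩ := hpow a a.2 ha0
  obtain ⟨n, hn, hnP⟩ := hpow b b.2 hb0
  have hnQ := hnP
  rw [hPmem, W.mem_nonunits_iff_or, not_or, not_not] at hmP hnP
  rw [hPQ, hQmem, O.mem_nonunits_iff_or, not_or, not_not] at hnQ
  -- Up to factors invertible in both rings, `a / b` is `y ^ (n - m)`, and `y⁻¹` is a nonunit in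
  -- both; the sign of the exponent therefore decides membership in the nonunits of `W` and of `O`
  -- alike.
  rcases le_or_gt m n with hmn | hmn
  · exfalso
    have h1 := mul_mem (mul_mem (hRW _ hn) hmP.2)
      (pow_mem ((W.mem_or_inv_mem y).resolve_left hyW) (n - m))
    rcases W.mem_nonunits_iff_or.1 hw with h | h
    · exact hw0 h
    refine h ?_
    convert h1 using 1
    obtain ⟨c, rfl⟩ := Nat.exists_eq_add_of_le hmn
    rw [Nat.add_sub_cancel_left, pow_add]
    field_simp
    rw [one_div, ← mul_pow, mul_inv_cancel₀ hy0, one_pow]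
  · obtain ⟨c, rfl⟩ := Nat.exists_eq_add_of_lt hmn
    have h1 := O.mul_mem_nonunits (mul_mem (mul_mem (hRO _ hm) hnQ.2)
      (pow_mem (show y⁻¹ ∈ O from O.nonunits_subset hyO') c)) hyO'
    convert h1 using 1
    rw [pow_add, pow_add]
    field_simp
    rw [one_div, ← mul_pow, mul_inv_cancel₀ hy0, one_pow]

end FunctionField

/-! ### Smooth algebras of relative dimension one -/

section SmoothAlgebra

open KaehlerDifferential

/-- The local rings of a smooth algebra of relative dimension one over a perfect field that is an
integral domain are principal ideal rings. -/
theorem Algebra.IsStandardSmoothOfRelativeDimension.isPrincipalIdealRing_localization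
    (k R S : Type*) [Field k] [PerfectField k] [CommRing R] [IsDomain R] [Algebra k R]
    [Algebra.IsStandardSmoothOfRelativeDimension 1 k R] (p : Ideal R) [p.IsPrime]
    [CommRing S] [IsDomain S] [Algebra R S] [IsLocalization.AtPrime S p] :
    IsPrincipalIdealRing S := by
  have hsm : Algebra.IsStandardSmooth k R :=
    Algebra.IsStandardSmoothOfRelativeDimension.isStandardSmooth 1
  have hR : IsNoetherianRing R := Algebra.FiniteType.isNoetherianRing k R
  have hS : IsNoetherianRing S := IsLocalization.isNoetherianRing p.primeCompl S hR
  have hSl : IsLocalRing S := IsLocalization.AtPrime.isLocalRing S p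
  let _ : Algebra k S := ((algebraMap R S).comp (algebraMap k R)).toAlgebra
  have : IsScalarTower k R S := IsScalarTower.of_algebraMap_eq' rfl
  have hess : Algebra.EssFiniteType k S :=
    have := Algebra.EssFiniteType.of_isLocalization S p.primeCompl
    Algebra.EssFiniteType.comp k R S
  have hfs : Algebra.FormallySmooth k S :=
    have := Algebra.FormallyEtale.of_isLocalization (Rₘ := S) p.primeCompl
    Algebra.FormallySmooth.comp k R S
  let B := IsLocalRing.ResidueField S
  have hessB : Algebra.EssFiniteType k B := Algebra.EssFiniteType.comp k S B
  have hfsB : Algebra.FormallySmooth k B := inferInstance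
  have hsurj : Function.Surjective (algebraMap S B) := IsLocalRing.residue_surjective
  -- Over a perfect field the residue field is formally smooth, so the cotangent space embeds into
  -- `B ⊗ Ω[S⁄k]`, of dimension one. A Noetherian local domain whose cotangent space has dimension
  -- at most one is principal.
  obtain ⟨l, hl⟩ := (Algebra.FormallySmooth.iff_split_injection (R := k) (P := S) (A := B) hsurj).1 hfsB
  have hinj : Function.Injective (kerCotangentToTensor k S B) :=
    Function.LeftInverse.injective (g := l) fun x => LinearMap.congr_fun hl x
  have hker : IsLocalRing.maximalIdeal S = RingHom.ker (algebraMap S B) :=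
    IsLocalRing.ker_residue.symm
  have hφ : ∀ I : Ideal S, I = RingHom.ker (algebraMap S B) →
      ∃ φ : I.Cotangent →ₗ[S] B ⊗[S] Ω[S⁄k], Function.Injective φ := by
    rintro _ rfl
    exact ⟨_, hinj⟩
  obtain ⟨φ, hφ⟩ := hφ _ hker
  have hfree : Module.Free R Ω[R⁄k] := inferInstance
  have hrank : Module.finrank R Ω[R⁄k] = 1 := by
    rw [Module.finrank, Algebra.IsStandardSmoothOfRelativeDimension.rank_kaehlerDifferential 1]
    simp
  have hΩ : Module.finrank S Ω[S⁄k] = 1 := by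
    rw [Module.finrank_of_isLocalizedModule_of_free S p.primeCompl (KaehlerDifferential.map k k R S),
      hrank]
  have hΩf : Module.Free S Ω[S⁄k] :=
    Module.free_of_isLocalizedModule p.primeCompl (KaehlerDifferential.map k k R S)
  have := ((tfae_of_isNoetherianRing_of_isLocalRing_of_isDomain S).out 0 5).2
  refine this ?_
  let φ' : IsLocalRing.CotangentSpace S →ₗ[B] B ⊗[S] Ω[S⁄k] := φ.extendScalarsOfSurjective hsurj
  have hfg : Module.Finite S Ω[S⁄k] := inferInstance
  refine (LinearMap.finrank_le_finrank_of_injective (f := φ') hφ).trans ?_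
  rw [Module.finrank_baseChange, hΩ]

/-- An étale coordinate supplies `x`: the field `K` is formally unramified and essentially of finite
type over `k(x)`, hence finite over it. -/
theorem Algebra.IsStandardSmoothOfRelativeDimension.exists_finiteDimensional_adjoin
    (k R K : Type*) [Field k] [CommRing R] [IsDomain R] [Algebra k R]
    [Algebra.IsStandardSmoothOfRelativeDimension 1 k R]
    [Field K] [Algebra R K] [IsFractionRing R K] [Algebra k K] [IsScalarTower k R K] :
    ∃ x : K, FiniteDimensional (IntermediateField.adjoin k {x}) K := by
  obtain ⟨g, hg⟩ := Algebra.IsStandardSmoothOfRelativeDimension.exists_etale_mvPolynomial 1 k R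
  algebraize [g.toRingHom]
  have hsm : Algebra.IsStandardSmooth k R :=
    Algebra.IsStandardSmoothOfRelativeDimension.isStandardSmooth 1
  have hess : Algebra.EssFiniteType k K :=
    have := Algebra.EssFiniteType.of_isLocalization K (nonZeroDivisors R)
    Algebra.EssFiniteType.comp k R K
  let x : K := algebraMap R K (g (MvPolynomial.X 0))
  refine ⟨x, ?_⟩
  let F := IntermediateField.adjoin k {x}
  let h : MvPolynomial (Fin 1) k →ₐ[k] F :=
    MvPolynomial.aeval fun _ => ⟨x, IntermediateField.mem_adjoin_simple_self k x⟩
  let _ : Algebra (MvPolynomial (Fin 1) k) K := ((algebraMap R K).comp g.toRingHom).toAlgebra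
  have : IsScalarTower (MvPolynomial (Fin 1) k) R K := IsScalarTower.of_algebraMap_eq' rfl
  let _ : Algebra (MvPolynomial (Fin 1) k) F := h.toRingHom.toAlgebra
  have : IsScalarTower (MvPolynomial (Fin 1) k) F K := by
    refine IsScalarTower.of_algebraMap_eq' ?_
    change ((IsScalarTower.toAlgHom k R K).comp g).toRingHom = (F.val.comp h).toRingHom
    congr 1
    refine MvPolynomial.algHom_ext fun i => ?_
    rw [Subsingleton.elim i 0]
    simp [h, x]
  have : Algebra.FormallyUnramified R K :=
    Algebra.FormallyUnramified.of_isLocalization (nonZeroDivisors R)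
  have : Algebra.FormallyUnramified (MvPolynomial (Fin 1) k) K :=
    Algebra.FormallyUnramified.comp _ R K
  have : Algebra.FormallyUnramified F K :=
    Algebra.FormallyUnramified.of_restrictScalars (MvPolynomial (Fin 1) k) F K
  have : Algebra.EssFiniteType F K := Algebra.EssFiniteType.of_comp k F K
  exact Algebra.FormallyUnramified.finite_of_free F K

-- The transcendence degree is at most one, so `t` is a transcendence basis and `K` is algebraic
-- over `k(t)`. In characteristic zero it is separable, and being essentially of finite type it is
-- finite.
open scoped IntermediateField.algebraAdjoinAdjoin in
theorem finiteDimensional_adjoin_of_transcendental {k K : Type*} [Field k] [CharZero k] [Field K]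
    [Algebra k K] [Algebra.EssFiniteType k K] {x t : K}
    [hx : FiniteDimensional (IntermediateField.adjoin k {x}) K]
    (ht : Transcendental k t) : FiniteDimensional (IntermediateField.adjoin k {t}) K := by
  have htr : Algebra.trdeg k K ≤ 1 := by
    have : Algebra.IsAlgebraic (Algebra.adjoin k {x}) K :=
      (IsFractionRing.comap_isAlgebraic_iff (K := IntermediateField.adjoin k {x})).2 inferInstance
    simpa using Algebra.IsAlgebraic.trdeg_le_cardinalMk (R := k) (s := ({x} : Set K))
  have hti : IsTranscendenceBasis k (fun _ : PUnit => t) :=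
    AlgebraicIndependent.isTranscendenceBasis_of_trdeg_le_of_finite
      (algebraicIndependent_unique_type_iff.2 ht) (by simpa using htr)
  have : Algebra.IsAlgebraic (IntermediateField.adjoin k {t}) K := by
    have := hti.isAlgebraic_field
    rwa [Set.range_const] at this
  have : Algebra.EssFiniteType (IntermediateField.adjoin k {t}) K :=
    Algebra.EssFiniteType.of_comp k _ K
  have : Algebra.IsSeparable (IntermediateField.adjoin k {t}) K := inferInstance
  have : Algebra.FormallyUnramified (IntermediateField.adjoin k {t}) K :=
    Algebra.FormallyUnramified.of_isSeparable _ _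
  exact Algebra.FormallyUnramified.finite_of_free _ K

/-- Otherwise `K` is algebraic over the algebraically closed `k`, so `R = k` and `Ω[R⁄k] = 0`,
against its rank being one. -/
theorem Algebra.IsStandardSmoothOfRelativeDimension.exists_transcendental
    (k R K : Type*) [Field k] [IsAlgClosed k] [CommRing R] [IsDomain R] [Algebra k R]
    [Algebra.IsStandardSmoothOfRelativeDimension 1 k R]
    [Field K] [Algebra R K] [IsFractionRing R K] [Algebra k K] [IsScalarTower k R K] :
    ∃ x : K, Transcendental k x := by
  by_contra hcon
  push Not at hcon
  have halg : Algebra.IsAlgebraic k K := ⟨fun x => not_not.1 (hcon x)⟩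
  have hbij := IsAlgClosed.algebraMap_bijective_of_isIntegral (k := k) (K := K)
  have hsurj : Function.Surjective (algebraMap k R) := by
    intro r
    obtain ⟨c, hc⟩ := hbij.2 (algebraMap R K r)
    refine ⟨c, IsFractionRing.injective R K ?_⟩
    rw [← hc, ← IsScalarTower.algebraMap_apply]
  have hsub : Subsingleton Ω[R⁄k] := KaehlerDifferential.subsingleton_of_surjective k R hsurj
  have := Algebra.IsStandardSmoothOfRelativeDimension.rank_kaehlerDifferential (R := k) (S := R) 1
  rw [rank_subsingleton'] at this
  simp at this

end SmoothAlgebra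

/-! ### Standard smooth charts of the curve -/

namespace SmoothCurve

variable {k : Type u} [Field k] (C : SmoothCurve k)

theorem exists_chart (x : C.X) : ∃ V : C.X.Opens, IsAffineOpen V ∧ x ∈ V ∧
    ∃ φ : k →+* Γ(C.X, V), φ.IsStandardSmoothOfRelativeDimension 1 ∧
      ∀ _ : Nonempty V, (algebraMap Γ(C.X, V) C.RatFun).comp φ = algebraMap k C.RatFun := by
  have := C.smooth
  obtain ⟨U, hU, V, hV, hx, e, hs⟩ :=
    SmoothOfRelativeDimension.exists_isStandardSmoothOfRelativeDimension (n := 1) (f := C.str) x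
  -- The base is a single point, so a nonempty open set is everything.
  have hUtop : U = ⊤ := by
    rw [eq_top_iff]
    intro y _
    have hsub : Subsingleton (Spec (CommRingCat.of k)) :=
      inferInstanceAs (Subsingleton (PrimeSpectrum k))
    rw [Subsingleton.elim y (C.str x)]
    exact e hx
  subst hUtop
  refine ⟨V, hV, hx, (C.str.appLE ⊤ V e).hom.comp (Scheme.ΓSpecIso (CommRingCat.of k)).inv.hom, ?_, ?_⟩
  · refine RingHom.isStandardSmoothOfRelativeDimension_respectsIso.2 _
      (Scheme.ΓSpecIso (CommRingCat.of k)).symm.commRingCatIsoToRingEquiv hs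
  · intro h
    change _ = (algebraMap C.Reg C.RatFun).comp ((C.str.appTop).hom.comp _)
    rw [← RingHom.comp_assoc, ← RingHom.comp_assoc]
    congr 1
    change (C.str.appLE ⊤ V e ≫ C.X.germToFunctionField V).hom =
      (C.str.appTop ≫ C.X.germToFunctionField ⊤).hom
    congr 1
    have h1 : C.str.appLE ⊤ V e = C.str.appTop ≫ C.X.presheaf.map (homOfLE (le_top : V ≤ ⊤)).op := rfl
    rw [h1, Category.assoc]
    congr 1
    exact C.X.presheaf.germ_res _ _ _

end SmoothCurve

namespace SmoothCurve

variable {k : Type u} [Field k] (C : SmoothCurve k)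

/-! ### Local rings of the curve -/

section Stalks

theorem isPrincipalIdealRing_stalk [PerfectField k] (x : C.X) :
    IsPrincipalIdealRing (C.X.presheaf.stalk x) := by
  obtain ⟨V, hV, hx, φ, hφ, -⟩ := C.exists_chart x
  algebraize [φ]
  have : Nonempty V := ⟨⟨x, hx⟩⟩
  let _ := C.X.presheaf.algebra_section_stalk (U := V) ⟨x, hx⟩
  have hloc := hV.isLocalization_stalk ⟨x, hx⟩
  exact Algebra.IsStandardSmoothOfRelativeDimension.isPrincipalIdealRing_localization k Γ(C.X, V)
    (C.X.presheaf.stalk x) (hV.primeIdealOf ⟨x, hx⟩).asIdeal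

instance isDiscreteValuationRing_stalk [PerfectField k] (z : C.Point) :
    IsDiscreteValuationRing (C.X.presheaf.stalk z.1) := by
  have := C.isPrincipalIdealRing_stalk z.1
  refine { not_a_field' := fun h => ?_ }
  have h1 := ringKrullDim_eq_zero_of_isField (IsLocalRing.isField_iff_maximalIdeal_eq.2 h)
  rw [ringKrullDim_stalk_eq_coheight, z.2] at h1
  norm_num at h1

/-- The stalk is a local principal ideal domain: either a field, and then it is all of `k(C)`, or a
discrete valuation ring, of dimension one. -/
theorem coheight_eq_one_or_surjective [PerfectField k] (x : C.X) : coheight x = 1 ∨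
    Function.Surjective (algebraMap (C.X.presheaf.stalk x) C.RatFun) := by
  have := C.isPrincipalIdealRing_stalk x
  by_cases h : IsField (C.X.presheaf.stalk x)
  · right
    exact (IsField.localization_map_bijective (M := nonZeroDivisors _)
      (flip nonZeroDivisors.ne_zero rfl) h).2
  · left
    have : IsDiscreteValuationRing (C.X.presheaf.stalk x) :=
      { not_a_field' := fun h' => h (IsLocalRing.isField_iff_maximalIdeal_eq.2 h') }
    have h1 := ringKrullDim_stalk_eq_coheight x
    rw [IsDiscreteValuationRing.ringKrullDim_eq_one] at h1
    exact_mod_cast h1.symm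

theorem ord_nonneg_iff [PerfectField k] (z : C.Point) {g : C.RatFun} (hg : g ≠ 0) :
    0 ≤ C.ord z g ↔ g ∈ Set.range (algebraMap (C.X.presheaf.stalk z.1) C.RatFun) := by
  rw [ord, Scheme.le_ord_iff z.2 hg, ofAdd_zero, WithZero.coe_one]
  have : Ring.KrullDimLE 1 (C.X.presheaf.stalk z.1) := krullDimLE_of_coheight_le z.2.le
  change 1 ≤ Ring.ordFrac (C.X.presheaf.stalk z.1) g ↔ _
  rw [Ring.ordFrac_eq_valuation_inv,
    one_le_inv₀ (zero_lt_iff.2 ((map_ne_zero _).2 hg))]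
  constructor
  · exact fun h => IsDiscreteValuationRing.exists_lift_of_le_one h
  · rintro ⟨a, rfl⟩
    exact IsDedekindDomain.HeightOneSpectrum.valuation_le_one _ a

end Stalks

/-! ### Orders of vanishing and regular functions -/

section Ord

theorem genericPoint_mem {U : C.X.Opens} (hU : (U : Set C.X).Nonempty) : genericPoint C.X ∈ U :=
  ((genericPoint_spec C.X).mem_open_set_iff U.isOpen).2 (by simpa using hU)

theorem ord_zero (z : C.Point) : C.ord z 0 = 0 := by simp [ord]

theorem ord_mul (z : C.Point) {f g : C.RatFun} (hf : f ≠ 0) (hg : g ≠ 0) :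
    C.ord z (f * g) = C.ord z f + C.ord z g :=
  Scheme.ord_mul hf hg

theorem ord_one (z : C.Point) : C.ord z 1 = 0 := by
  have := C.ord_mul z (one_ne_zero (α := C.RatFun)) one_ne_zero
  rw [mul_one] at this
  linarith

theorem ord_inv (z : C.Point) {f : C.RatFun} (hf : f ≠ 0) : C.ord z f⁻¹ = -C.ord z f := by
  have := C.ord_mul z hf (inv_ne_zero hf)
  rw [mul_inv_cancel₀ hf, ord_one] at this
  linarith

theorem ord_pow (z : C.Point) {f : C.RatFun} (hf : f ≠ 0) (n : ℕ) :
    C.ord z (f ^ n) = n * C.ord z f := by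
  induction n with
  | zero => simp [ord_one]
  | succ n ih =>
    rw [pow_succ, C.ord_mul z (pow_ne_zero n hf) hf, ih]
    push_cast
    ring

theorem ord_prod (z : C.Point) {ι : Type*} (s : Finset ι) {f : ι → C.RatFun} (hf : ∀ i, f i ≠ 0) :
    C.ord z (∏ i ∈ s, f i) = ∑ i ∈ s, C.ord z (f i) := by
  classical
  induction s using Finset.induction_on with
  | empty => simp [ord_one]
  | insert i s hi ih =>
    rw [Finset.prod_insert hi, Finset.sum_insert hi,
      C.ord_mul z (hf i) (Finset.prod_ne_zero_iff.2 fun j _ => hf j), ih]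

theorem ord_add [PerfectField k] (z : C.Point) {f g : C.RatFun} (hfg : f + g ≠ 0) :
    min (C.ord z f) (C.ord z g) ≤ C.ord z (f + g) :=
  Scheme.ord_add hfg

theorem ord_algebraMap_nonneg [PerfectField k] (z : C.Point) (a : C.Reg) :
    0 ≤ C.ord z (algebraMap C.Reg C.RatFun a) := by
  by_cases ha : algebraMap C.Reg C.RatFun a = 0
  · rw [ha, ord_zero]
  rw [C.ord_nonneg_iff z ha]
  exact ⟨C.X.presheaf.germ ⊤ z.1 trivial a, Scheme.algebraMap_germ_eq_germToFunctionField (X := C.X) (U := ⊤) (x := z.1) _ a⟩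

theorem ord_algebraMap_const (z : C.Point) (c : k) : C.ord z (algebraMap k C.RatFun c) = 0 := by
  by_cases hc : c = 0
  · rw [hc, map_zero, ord_zero]
  exact Scheme.ord_of_isUnit (U := ⊤) ((isUnit_iff_ne_zero.2 hc).map C.const) trivial

/-- Such a `g` lies in every stalk, so it extends locally around every point. The local extensions
have the same image in the function field, hence agree on overlaps and glue. -/
theorem mem_range_of_ord_nonneg [PerfectField k] (g : C.RatFun) (hg : ∀ z, 0 ≤ C.ord z g) :
    g ∈ Set.range (algebraMap C.Reg C.RatFun) := by
  by_cases hg0 : g = 0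
  · exact ⟨0, by rw [map_zero, hg0]⟩
  have h1 : ∀ x : C.X, g ∈ Set.range (algebraMap (C.X.presheaf.stalk x) C.RatFun) := by
    intro x
    rcases C.coheight_eq_one_or_surjective x with hx | hx
    · exact (C.ord_nonneg_iff ⟨x, hx⟩ hg0).1 (hg _)
    · exact hx g
  have h2 : ∀ x : C.X, ∃ (U : C.X.Opens) (_ : x ∈ U) (a : Γ(C.X, U)), ∀ h : Nonempty U,
      C.X.germToFunctionField U a = g := by
    intro x
    obtain ⟨s, hs⟩ := h1 x
    obtain ⟨U, hxU, a, rfl⟩ := C.X.presheaf.exists_germ_eq s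
    refine ⟨U, hxU, a, fun h => ?_⟩
    rw [← hs, Scheme.algebraMap_germ_eq_germToFunctionField]
  choose U hU a ha using h2
  have hcompat : TopCat.Presheaf.IsCompatible C.X.presheaf U a := by
    intro x y
    have hη : genericPoint C.X ∈ U x ⊓ U y :=
      ⟨C.genericPoint_mem ⟨x, hU x⟩, C.genericPoint_mem ⟨y, hU y⟩⟩
    have hne : Nonempty (U x ⊓ U y : C.X.Opens) := ⟨⟨_, hη⟩⟩
    refine Scheme.germToFunctionField_injective (X := C.X) (U x ⊓ U y) ?_
    have h1 := ha x ⟨⟨x, hU x⟩⟩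
    have h2 := ha y ⟨⟨y, hU y⟩⟩
    refine ((C.X.presheaf.germ_res_apply _ _ hη _).trans h1).trans
      ((C.X.presheaf.germ_res_apply _ _ hη _).trans h2).symm
  obtain ⟨s, hs, -⟩ := C.X.sheaf.existsUnique_gluing' U ⊤ (fun i => homOfLE le_top)
    (fun x _ => TopologicalSpace.Opens.mem_iSup.2 ⟨x, hU x⟩) a hcompat
  refine ⟨s, ?_⟩
  rw [← ha (genericPoint C.X) ⟨⟨_, hU _⟩⟩, ← hs (genericPoint C.X)]
  exact (C.X.presheaf.germ_res_apply (homOfLE le_top) _ (hU (genericPoint C.X)) s).symm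

/-- Away from a nonempty open set `U` where `g` is invertible there are finitely many irreducible
components. A point of codimension one outside `U` is the generic point of such a component:
otherwise that generic point would lie strictly between it and the generic point of `C`. -/
theorem finite_ord_ne_zero {g : C.RatFun} (hg : g ≠ 0) : {z | C.ord z g ≠ 0}.Finite := by
  obtain ⟨U, hU, a, hne, rfl, ha⟩ := exists_isUnit_germ_eq C.X g hg
  have hcomp : CompactSpace C.X :=
    
    have := C.quasiCompact
    QuasiCompact.compactSpace_of_compactSpace C.str
  have hNoeth : IsNoetherian C.X := {}
  obtain ⟨S, hS, hcl, hirr, hSU⟩ :=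
    TopologicalSpace.NoetherianSpace.exists_finite_set_isClosed_irreducible U.isOpen.isClosed_compl
  have hclosure : ∀ z : C.Point, C.ord z (C.X.germToFunctionField U a) ≠ 0 →
      closure {z.1} ∈ S := by
    intro z hz
    have hzU : z.1 ∈ (U : Set C.X)ᶜ := fun h => hz (Scheme.ord_of_isUnit ha h)
    rw [hSU] at hzU
    obtain ⟨t, ht, hzt⟩ := hzU
    have hgc := (hirr t ht).genericPoint_closure_eq
    rw [(hcl t ht).closure_eq] at hgc
    suffices h : (hirr t ht).genericPoint = z.1 by rwa [← h, hgc]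
    set g := (hirr t ht).genericPoint with hg
    have hgz : g ⤳ z.1 := specializes_iff_mem_closure.2 (hgc ▸ hzt)
    have hgU : g ∉ U := by
      have : g ∈ (U : Set C.X)ᶜ := hSU ▸ ⟨t, ht, hgc ▸ subset_closure rfl⟩
      exact this
    have hηg : genericPoint C.X ⤳ g := genericPoint_specializes g
    have hηU := C.genericPoint_mem (U := U) (by obtain ⟨x, hx⟩ := hne; exact ⟨x, hx⟩)
    by_contra hne'
    have hlt1 : z.1 < g := lt_of_le_not_ge (Scheme.le_iff_specializes.2 hgz) fun h =>
      hne' ((Scheme.le_iff_specializes.1 h).antisymm hgz).symm.eq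
    have hlt2 : g < genericPoint C.X := lt_of_le_not_ge (Scheme.le_iff_specializes.2 hηg) fun h =>
      hgU (((Scheme.le_iff_specializes.1 h).antisymm hηg).eq ▸ hηU)
    have h1 := coheight_add_one_le hlt1
    have h2 := coheight_add_one_le hlt2
    rw [z.2] at h1
    have h3 : (0 + 1 : ℕ∞) + 1 ≤ 1 :=
      (add_le_add_left ((add_le_add_left zero_le 1).trans h2) 1).trans h1
    norm_num at h3
  refine Set.Finite.of_injOn (f := fun z : C.Point => closure {z.1}) hclosure ?_ hS
  intro z _ w _ hzw
  exact Subtype.ext ((inseparable_iff_closure_eq.2 hzw).eq)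

theorem exists_transcendental [IsAlgClosed k] : ∃ t : C.RatFun, Transcendental k t := by
  obtain ⟨V, hV, hx, φ, hφ, hφ'⟩ := C.exists_chart (genericPoint C.X)
  algebraize [φ]
  have : Nonempty V := ⟨⟨_, hx⟩⟩
  have := functionField_isFractionRing_of_isAffineOpen C.X V hV
  have : IsScalarTower k Γ(C.X, V) C.RatFun := IsScalarTower.of_algebraMap_eq' (hφ' ‹_›).symm
  exact Algebra.IsStandardSmoothOfRelativeDimension.exists_transcendental k Γ(C.X, V) C.RatFun

theorem finiteDimensional_of_transcendental [CharZero k] {t : C.RatFun} (ht : Transcendental k t) :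
    FiniteDimensional (IntermediateField.adjoin k {t}) C.RatFun := by
  obtain ⟨V, hV, hx, φ, hφ, hφ'⟩ := C.exists_chart (genericPoint C.X)
  algebraize [φ]
  have : Nonempty V := ⟨⟨_, hx⟩⟩
  have := functionField_isFractionRing_of_isAffineOpen C.X V hV
  have : IsScalarTower k Γ(C.X, V) C.RatFun := IsScalarTower.of_algebraMap_eq' (hφ' ‹_›).symm
  obtain ⟨x, hx⟩ := Algebra.IsStandardSmoothOfRelativeDimension.exists_finiteDimensional_adjoin
    k Γ(C.X, V) C.RatFun
  have hsm : Algebra.IsStandardSmooth k Γ(C.X, V) :=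
    Algebra.IsStandardSmoothOfRelativeDimension.isStandardSmooth 1
  have : Algebra.EssFiniteType k C.RatFun :=
    have := Algebra.EssFiniteType.of_isLocalization C.RatFun (nonZeroDivisors Γ(C.X, V))
    Algebra.EssFiniteType.comp k Γ(C.X, V) C.RatFun
  exact finiteDimensional_adjoin_of_transcendental (x := x) ht

end Ord

/-! ### Valuation rings of `k(C)` over `k[C]` -/

section Valuations

/-- The valuation ring of `k(C)` at a point of the curve. -/
def localRing [PerfectField k] (z : C.Point) : ValuationSubring C.RatFun where
  carrier := {g | 0 ≤ C.ord z g}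
  mul_mem' := by
    intro f g hf hg
    by_cases hf0 : f = 0
    · simp [hf0, ord_zero]
    by_cases hg0 : g = 0
    · simp [hg0, ord_zero]
    simp only [Set.mem_ofPred_eq] at *
    rw [C.ord_mul z hf0 hg0]
    positivity
  one_mem' := (C.ord_one z).ge
  add_mem' := by
    intro f g hf hg
    by_cases hfg : f + g = 0
    · simp [hfg, ord_zero]
    exact (le_min hf hg).trans (C.ord_add z hfg)
  zero_mem' := (C.ord_zero z).ge
  neg_mem' := by
    intro f hf
    by_cases hf0 : f = 0
    · simp [hf0, ord_zero]
    have h := C.ord_mul z (neg_ne_zero.2 (one_ne_zero (α := C.RatFun))) hf0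
    have h1 := C.ord_algebraMap_const z (-1)
    rw [map_neg, map_one] at h1
    rw [neg_one_mul, h1, zero_add] at h
    exact hf.trans_eq h.symm
  mem_or_inv_mem' := by
    intro f
    by_cases hf0 : f = 0
    · simp [hf0, ord_zero]
    simp only [Set.mem_ofPred_eq, C.ord_inv z hf0]
    omega

theorem mem_localRing [PerfectField k] {z : C.Point} {g : C.RatFun} :
    g ∈ C.localRing z ↔ 0 ≤ C.ord z g := Iff.rfl

/-- A valuation ring of `k(C)` that contains `k[C]` is either trivial or centred at a point
of `C`. -/
theorem eq_top_or_exists_localRing_le [IsAlgClosed k] [CharZero k] (W : ValuationSubring C.RatFun)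
    (hW : ∀ a : C.Reg, algebraMap C.Reg C.RatFun a ∈ W) : W = ⊤ ∨ ∃ z, C.localRing z ≤ W := by
  by_contra! hcon
  obtain ⟨htop, hcon⟩ := hcon
  have hWk : ∀ c : k, algebraMap k C.RatFun c ∈ W := fun c => hW (C.const c)
  obtain ⟨s, hs⟩ : ∃ s, s ∉ W := by
    by_contra! h
    exact htop (eq_top_iff.2 fun x _ => h x)
  have hs0 : s ≠ 0 := by rintro rfl; exact hs W.zero_mem
  -- If algebraic, `s⁻¹` would be a constant because `k` is algebraically closed, and then `s` would
  -- lie in `W`.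
  have hst : Transcendental k s⁻¹ := by
    intro halg
    have : Algebra.IsAlgebraic k (IntermediateField.adjoin k {s⁻¹}) := by
      exact IntermediateField.isAlgebraic_adjoin_simple halg.isIntegral
    obtain ⟨c, hc⟩ := (IsAlgClosed.algebraMap_bijective_of_isIntegral
      (k := k) (K := IntermediateField.adjoin k {s⁻¹})).2
        ⟨_, IntermediateField.mem_adjoin_simple_self k _⟩
    have hc' : algebraMap k C.RatFun c = s⁻¹ := congrArg Subtype.val hc
    refine hs ?_
    rw [← inv_inv s, ← hc', ← map_inv₀]
    exact hWk _
  have := C.finiteDimensional_of_transcendental hst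
  obtain ⟨u, huW, hu⟩ := exists_function_with_single_pole hst W hWk (by rwa [inv_inv])
  -- A pole of `u` at `z` would put the local ring of `z` inside `W`. So `u` is regular on `C`,
  -- hence in `k[C] ⊆ W`, a contradiction.
  have huO : ∀ z, 0 ≤ C.ord z u := by
    intro z
    by_contra h
    exact hcon z (hu (C.localRing z) (fun c => (C.ord_algebraMap_const z c).ge) h)
  obtain ⟨a, rfl⟩ := C.mem_range_of_ord_nonneg u huO
  exact huW (hW a)

end Valuations

end SmoothCurve

/-! ### Lattice points and support functions -/

section LatticeFacts

variable {N : Type v} [AddCommGroup N]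

/-- The canonical map `M → M_ℚ` as a homomorphism. -/
noncomputable def toMQHom : LatM N →+ MQ N where
  toFun := toMQ
  map_zero' := by
    refine LinearMap.ext fun v => ?_
    induction v using TensorProduct.induction_on with
    | zero => simp
    | tmul q n => simp [toMQ_tmul]
    | add v w hv hw => rw [map_add, hv, hw, map_add]
  map_add' a b := by
    refine LinearMap.ext fun v => ?_
    induction v using TensorProduct.induction_on with
    | zero => simp
    | tmul q n => simp [toMQ_tmul, mul_add]
    | add v w hv hw => rw [map_add, hv, hw, map_add]

theorem toMQHom_apply (m : LatM N) : toMQHom m = toMQ m := rfl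

theorem toMQ_add (a b : LatM N) : toMQ (a + b) = toMQ a + toMQ b := toMQHom.map_add a b

theorem toMQ_zero : toMQ (0 : LatM N) = 0 := toMQHom.map_zero

theorem toMQ_nsmul (n : ℕ) (a : LatM N) : toMQ (n • a) = (n : ℚ) • toMQ a := by
  rw [Nat.cast_smul_eq_nsmul]
  exact toMQHom.map_nsmul n a

theorem toMQ_sum_nsmul {ι : Type*} (s : Finset ι) (c : ι → ℕ) (m : ι → LatM N) :
    toMQ (∑ i ∈ s, c i • m i) = ∑ i ∈ s, (c i : ℚ) • toMQ (m i) := by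
  rw [← toMQHom_apply, map_sum]
  exact Finset.sum_congr rfl fun i _ => toMQ_nsmul _ _

theorem toMQ_injective : Function.Injective (toMQ : LatM N → MQ N) := by
  intro a b h
  refine LinearMap.ext fun n => ?_
  have := LinearMap.congr_fun h (1 ⊗ₜ n)
  rw [toMQ_tmul, toMQ_tmul, one_mul, one_mul] at this
  exact_mod_cast this

theorem exists_pos_nat_mul_eq_natCast {ι : Type*} [Fintype ι] (c : ι → ℚ) :
    ∃ n : ℕ, 0 < n ∧ ∀ i, ∃ a : ℤ, (a : ℚ) = n * c i := by
  refine ⟨∏ i, (c i).den, Finset.prod_pos fun i _ => (c i).den_pos, fun i => ?_⟩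
  obtain ⟨d, hd⟩ := Finset.dvd_prod_of_mem (fun i => (c i).den) (Finset.mem_univ i)
  refine ⟨d * (c i).num, ?_⟩
  rw [hd]
  push_cast
  nth_rw 3 [← Rat.num_div_den (c i)]
  field_simp

theorem exists_nsmul_eq_toMQ [Module.Free ℤ N] [Module.Finite ℤ N] (l : MQ N) :
    ∃ n : ℕ, 0 < n ∧ ∃ m : LatM N, toMQ m = (n : ℚ) • l := by
  let b := Module.Free.chooseBasis ℤ N
  obtain ⟨n, hn, h⟩ := exists_pos_nat_mul_eq_natCast fun i => l (1 ⊗ₜ b i)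
  choose a ha using h
  refine ⟨n, hn, b.constr ℤ a, (b.baseChange ℚ).ext fun i => ?_⟩
  rw [Module.Basis.baseChange_apply, toMQ_tmul, b.constr_basis, one_mul, ha]
  rfl

theorem mem_dualCone {σ : PointedCone ℚ (NQ N)} {l : MQ N} :
    l ∈ dualCone σ ↔ ∀ v ∈ σ, 0 ≤ l v := by
  simp [dualCone]

theorem smul_mem_dualCone {σ : PointedCone ℚ (NQ N)} {l : MQ N} (hl : l ∈ dualCone σ) {c : ℚ}
    (hc : 0 ≤ c) : c • l ∈ dualCone σ :=
  mem_dualCone.2 fun v hv => mul_nonneg hc (mem_dualCone.1 hl v hv)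

variable {σ : PointedCone ℚ (NQ N)} {Δ : Set (NQ N)}

theorem supportFun_le (hΔ : IsTailPolyhedron σ Δ) {l : MQ N} (hl : l ∈ dualCone σ) {v : NQ N}
    (hv : v ∈ Δ) : supportFun Δ l ≤ l v :=
  (isLeast_supportFun hΔ hl).2 ⟨v, hv, rfl⟩

theorem exists_supportFun_eq (hΔ : IsTailPolyhedron σ Δ) {l : MQ N} (hl : l ∈ dualCone σ) :
    ∃ v ∈ Δ, l v = supportFun Δ l :=
  (isLeast_supportFun hΔ hl).1

theorem supportFun_smul (hΔ : IsTailPolyhedron σ Δ) {l : MQ N} (hl : l ∈ dualCone σ) {c : ℚ}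
    (hc : 0 ≤ c) : supportFun Δ (c • l) = c * supportFun Δ l := by
  have hcl := smul_mem_dualCone hl hc
  obtain ⟨v, hv, hvl⟩ := exists_supportFun_eq hΔ hl
  obtain ⟨w, hw, hwl⟩ := exists_supportFun_eq hΔ hcl
  refine le_antisymm ?_ ?_
  · rw [← hvl]
    exact supportFun_le hΔ hcl hv
  · rw [← hwl]
    exact mul_le_mul_of_nonneg_left (supportFun_le hΔ hl hw) hc

theorem supportFun_add_le (hΔ : IsTailPolyhedron σ Δ) {l l' : MQ N} (hl : l ∈ dualCone σ)
    (hl' : l' ∈ dualCone σ) : supportFun Δ l + supportFun Δ l' ≤ supportFun Δ (l + l') := by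
  obtain ⟨v, hv, hvl⟩ := exists_supportFun_eq hΔ (add_mem hl hl')
  rw [← hvl]
  exact add_le_add (supportFun_le hΔ hl hv) (supportFun_le hΔ hl' hv)

/-- A polyhedron with finitely generated tail cone is determined by its support function. -/
theorem subset_of_supportFun_le [Module.Free ℤ N] [Module.Finite ℤ N] (hσ : σ.FG) {Δ' : Set (NQ N)}
    (hΔ : IsTailPolyhedron σ Δ) (hΔ' : IsTailPolyhedron σ Δ')
    (h : ∀ m : LatM N, toMQ m ∈ dualCone σ → supportFun Δ (toMQ m) ≤ supportFun Δ' (toMQ m)) :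
    Δ' ⊆ Δ := by
  intro v hv
  by_contra hvΔ
  obtain ⟨Q, hQ, hQΔ⟩ := id hΔ
  rw [hQΔ] at hvΔ
  -- The separating functional is nonnegative on `σ`, so a positive multiple of it is a lattice
  -- point of `σ^∨`, where the support functions can be compared.
  obtain ⟨l, c, hl, hc, hlv⟩ := exists_dual_lt_of_notMem_add_convexHull hσ Q hvΔ
  have hl' : l ∈ dualCone σ := mem_dualCone.2 hl
  obtain ⟨n, hn, m, hm⟩ := exists_nsmul_eq_toMQ l
  have hn' : (0 : ℚ) < n := by exact_mod_cast hn
  have h1 := h m (by rw [hm]; exact smul_mem_dualCone hl' hn'.le)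
  rw [hm, supportFun_smul hΔ hl' hn'.le, supportFun_smul hΔ' hl' hn'.le] at h1
  have h2 := le_of_mul_le_mul_left h1 hn'
  have h3 := supportFun_le hΔ' hl' hv
  obtain ⟨w, hw, hwl⟩ := exists_supportFun_eq hΔ hl'
  rw [hQΔ] at hw
  obtain ⟨x, hx, y, hy, rfl⟩ := hw
  have hconv : Convex ℚ {x : NQ N | c ≤ l x} := convex_halfSpace_ge l.isLinear c
  have h4 : c ≤ l y := convexHull_min (fun q hq => hc q hq) hconv hy
  have h5 := hl x hx
  simp only [map_add] at hwl
  linarith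

end LatticeFacts

/-! ### The cone of the generators and integral duality -/

section Cone

variable {N : Type v} [AddCommGroup N] {r : ℕ} (m : Fin r → LatM N)

theorem mem_genCone {v : NQ N} : v ∈ genCone m ↔ ∀ i, 0 ≤ toMQ (m i) v := by
  rw [genCone, dualConeN, PointedCone.dual_hull]
  simp

theorem genCone_fg [Module.Free ℤ N] [Module.Finite ℤ N] : (genCone m).FG := by
  obtain ⟨S, hS⟩ := PointedCone.exists_finset_hull_eq_dual
    (Set.finite_range fun i => toMQ (m i))
  refine ⟨S, ?_⟩
  ext v
  rw [mem_genCone]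
  exact (hS v).trans (by simp)

theorem isTailPolyhedron_of_nonempty [Module.Free ℤ N] [Module.Finite ℤ N] (b : Fin r → ℚ)
    (hb : ∃ v : NQ N, ∀ i, b i ≤ toMQ (m i) v) :
    IsTailPolyhedron (genCone m) {v | ∀ i, b i ≤ toMQ (m i) v} := by
  obtain ⟨Q, hQ, h⟩ := exists_polyhedron_eq_add_convexHull (fun i => toMQ (m i)) b hb
  refine ⟨Q, hQ, h.trans ?_⟩
  congr 1
  ext v
  exact (mem_genCone m).symm

/-- A nonnegative integral combination of the `m_i` bounds the support function from below. -/
theorem sum_mul_le_supportFun {μ : LatM N} {s : ℕ} {a : Fin r → ℕ}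
    (ha : ∑ i, a i • m i = s • μ) {b : Fin r → ℚ}
    (hμ : toMQ μ ∈ dualCone (genCone m))
    (hb : IsTailPolyhedron (genCone m) {v | ∀ i, b i ≤ toMQ (m i) v}) :
    ∑ i, (a i : ℚ) * b i ≤ s * supportFun {v | ∀ i, b i ≤ toMQ (m i) v} (toMQ μ) := by
  obtain ⟨v, hv, hvμ⟩ := exists_supportFun_eq hb hμ
  rw [← hvμ]
  have h1 := LinearMap.congr_fun (toMQ_sum_nsmul Finset.univ a m) v
  rw [ha, toMQ_nsmul] at h1
  simp only [LinearMap.smul_apply, LinearMap.sum_apply, smul_eq_mul] at h1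
  rw [h1]
  exact Finset.sum_le_sum fun i _ => mul_le_mul_of_nonneg_left (hv i) (Nat.cast_nonneg _)

theorem exists_nat_combination {l : LatM N} {c : Fin r → ℚ} (hc : ∀ i, 0 ≤ c i)
    (hsum : ∑ i, c i • toMQ (m i) = toMQ l) :
    ∃ s : ℕ, 0 < s ∧ ∃ a : Fin r → ℕ, (∀ i, (a i : ℚ) = s * c i) ∧ ∑ i, a i • m i = s • l := by
  obtain ⟨s, hs, h⟩ := exists_pos_nat_mul_eq_natCast c
  choose a ha using h
  have ha' : ∀ i, ((a i).toNat : ℚ) = s * c i := by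
    intro i
    have h0 : 0 ≤ a i := by
      have : (0 : ℚ) ≤ a i := by rw [ha]; exact mul_nonneg (Nat.cast_nonneg _) (hc i)
      exact_mod_cast this
    rw [← ha]
    exact_mod_cast congrArg (Int.cast : ℤ → ℚ) (Int.toNat_of_nonneg h0)
  refine ⟨s, hs, fun i => (a i).toNat, ha', toMQ_injective ?_⟩
  rw [toMQ_sum_nsmul, toMQ_nsmul, ← hsum, Finset.smul_sum]
  exact Finset.sum_congr rfl fun i _ => by rw [ha', mul_smul]

/-- Linear programming duality over the integers, with a common denominator for finitely many
right-hand sides. -/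
theorem exists_nat_combination_supportFun [Module.Free ℤ N] [Module.Finite ℤ N] {μ : LatM N}
    (hμ : toMQ μ ∈ dualCone (genCone m)) {B : Set (Fin r → ℚ)} (hB : B.Finite)
    (hne : ∀ b ∈ B, ∃ v : NQ N, ∀ i, b i ≤ toMQ (m i) v) :
    ∃ s : ℕ, 0 < s ∧ ∀ b ∈ B, ∃ a : Fin r → ℕ, ∑ i, a i • m i = s • μ ∧
      ∑ i, (a i : ℚ) * b i = s * supportFun {v | ∀ i, b i ≤ toMQ (m i) v} (toMQ μ) := by
  have key : ∀ b ∈ B, ∃ s : ℕ, 0 < s ∧ ∃ a : Fin r → ℕ, ∑ i, a i • m i = s • μ ∧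
      ∑ i, (a i : ℚ) * b i = s * supportFun {v | ∀ i, b i ≤ toMQ (m i) v} (toMQ μ) := by
    intro b hb
    have htail := isTailPolyhedron_of_nonempty m b (hne b hb)
    obtain ⟨c, hc, hsum, hle⟩ := exists_nonneg_combination (fun i => toMQ (m i)) b (hne b hb)
      (toMQ μ) _ fun v hv => supportFun_le htail hμ hv
    obtain ⟨s, hs, a, ha, hsum'⟩ := exists_nat_combination m hc hsum
    refine ⟨s, hs, a, hsum', le_antisymm (sum_mul_le_supportFun m hsum' hμ htail) ?_⟩
    refine (mul_le_mul_of_nonneg_left hle (Nat.cast_nonneg s)).trans_eq ?_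
    rw [Finset.mul_sum]
    exact Finset.sum_congr rfl fun i _ => by rw [ha, mul_assoc]
  choose! s hs a ha hab using key
  -- Each solution can be multiplied by a positive integer, so the product of the individual
  -- denominators works for all right-hand sides.
  refine ⟨∏ b ∈ hB.toFinset, s b, Finset.prod_pos fun b hb => hs b (hB.mem_toFinset.1 hb),
    fun b hb => ?_⟩
  obtain ⟨d, hd⟩ := Finset.dvd_prod_of_mem s (hB.mem_toFinset.2 hb)
  refine ⟨fun i => d * a b i, ?_, ?_⟩
  · rw [hd, mul_comm, mul_smul, ← ha b hb, Finset.smul_sum]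
    exact Finset.sum_congr rfl fun i _ => mul_smul _ _ _
  · rw [hd]
    push_cast
    rw [mul_comm (s b : ℚ), mul_assoc, ← hab b hb, Finset.mul_sum]
    exact Finset.sum_congr rfl fun i _ => mul_assoc _ _ _

end Cone

/-! ### Monomials in the generators -/

section Monomials

variable {k : Type u} [Field k] (C : SmoothCurve k) {N : Type v} [AddCommGroup N]
  {r : ℕ} (f : Fin r → C.RatFun) (m : Fin r → LatM N)

theorem single_prod_mem_genAlgebra (a : Fin r → ℕ) :
    AddMonoidAlgebra.single (∑ i, a i • m i) (∏ i, f i ^ a i) ∈ genAlgebra C f m := by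
  have h : ∀ s : Finset (Fin r),
      AddMonoidAlgebra.single (∑ i ∈ s, a i • m i) (∏ i ∈ s, f i ^ a i) ∈ genAlgebra C f m := by
    classical
    intro s
    induction s using Finset.induction_on with
    | empty => exact one_mem (genAlgebra C f m)
    | insert i s hi ih =>
      rw [Finset.sum_insert hi, Finset.prod_insert hi, ← AddMonoidAlgebra.single_mul_single,
        ← AddMonoidAlgebra.single_pow]
      have hi' : AddMonoidAlgebra.single (m i) (f i) ∈ genAlgebra C f m :=
        Algebra.subset_adjoin ⟨i, rfl⟩
      exact mul_mem (pow_mem hi' _) ih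
  exact h _

variable {f} in
theorem ord_prod_pow (hf : ∀ i, f i ≠ 0) (a : Fin r → ℕ) (z : C.Point) :
    C.ord z (∏ i, f i ^ a i) = ∑ i, a i * C.ord z (f i) := by
  rw [C.ord_prod z _ fun i => pow_ne_zero _ (hf i)]
  exact Finset.sum_congr rfl fun i _ => C.ord_pow z (hf i) _

-- All but finitely many points give the zero vector. This finiteness is what makes the multiple `s`
-- in `exists_monomial` independent of the point.
variable {f} in
theorem finite_range_neg_ord (hf : ∀ i, f i ≠ 0) :
    (Set.range fun (z : C.Point) (i : Fin r) => -(C.ord z (f i) : ℚ)).Finite := by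
  have hfin : (⋃ i, {z | C.ord z (f i) ≠ 0}).Finite :=
    Set.finite_iUnion fun i => C.finite_ord_ne_zero (hf i)
  refine ((hfin.image fun (z : C.Point) (i : Fin r) => -(C.ord z (f i) : ℚ)).insert 0).subset ?_
  rintro _ ⟨z, rfl⟩
  by_cases h : z ∈ ⋃ i, {z | C.ord z (f i) ≠ 0}
  · exact Or.inr ⟨z, h, rfl⟩
  · left
    funext i
    have : C.ord z (f i) = 0 := by
      by_contra hne
      exact h (Set.mem_iUnion.2 ⟨i, hne⟩)
    simp [this]

-- A certificate of emptiness, with denominators cleared, is a monomial in the generators of degree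
-- `0` and negative order at `z`; but elements of degree `0` in `A` are regular.
variable {f m} in
theorem genPolyhedron_nonempty [PerfectField k] [Module.Free ℤ N] [Module.Finite ℤ N]
    (hf : ∀ i, f i ≠ 0)
    (hzero : ∀ g : C.RatFun, AddMonoidAlgebra.single (0 : LatM N) g ∈ genAlgebra C f m →
      g ∈ Set.range (algebraMap C.Reg C.RatFun)) (z : C.Point) :
    ∃ v : NQ N, ∀ i, -(C.ord z (f i) : ℚ) ≤ toMQ (m i) v := by
  by_contra hne
  obtain ⟨c, hc, hsum, hpos⟩ :=
    exists_nonneg_combination_of_empty (fun i => toMQ (m i)) _ hne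
  obtain ⟨s, hs, a, ha, ham⟩ := exists_nat_combination m (l := 0) hc (hsum.trans toMQ_zero.symm)
  have hmem := single_prod_mem_genAlgebra C f m a
  rw [ham, smul_zero] at hmem
  obtain ⟨g, hg⟩ := hzero _ hmem
  have h1 := C.ord_algebraMap_nonneg z g
  rw [hg, ord_prod_pow C hf] at h1
  have h2 : (0 : ℚ) ≤ ∑ i, (a i : ℚ) * C.ord z (f i) := by exact_mod_cast h1
  have h3 : ∑ i, (a i : ℚ) * C.ord z (f i) = -(s * ∑ i, c i * -(C.ord z (f i) : ℚ)) := by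
    rw [Finset.mul_sum, ← Finset.sum_neg_distrib]
    exact Finset.sum_congr rfl fun i _ => by rw [ha]; ring
  have hs' : (0 : ℚ) < s := by exact_mod_cast hs
  have := mul_pos hs' hpos
  linarith

-- Orders are integers, so rounding down does not change the condition.
variable {C} in
theorem neg_le_ord_iff {g : C.RatFun} {z : C.Point} {q : ℚ} :
    0 ≤ C.ord z g + ⌊q⌋ ↔ -q ≤ C.ord z g := by
  rw [← neg_le_iff_add_nonneg', Int.le_floor]
  push_cast
  exact neg_le

variable {C} in
theorem coeff_algebraMap_reg {a : C.Reg} {μ : LatM N}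
    (h : (algebraMap C.Reg (AddMonoidAlgebra C.RatFun (LatM N)) a).coeff μ ≠ 0) :
    μ = 0 ∧ (algebraMap C.Reg (AddMonoidAlgebra C.RatFun (LatM N)) a).coeff μ =
      algebraMap C.Reg C.RatFun a := by
  classical
  have h0 : algebraMap C.Reg (AddMonoidAlgebra C.RatFun (LatM N)) a =
    AddMonoidAlgebra.single 0 (algebraMap C.Reg C.RatFun a) := by simp
  rw [h0, AddMonoidAlgebra.coeff_single] at h ⊢
  have hμ : μ = 0 := by
    by_contra hne
    exact h (Finsupp.single_eq_of_ne hne)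
  subst hμ
  exact ⟨rfl, Finsupp.single_eq_same⟩

variable {C f m} in
theorem coeff_generator {x : AddMonoidAlgebra C.RatFun (LatM N)}
    (hx : x ∈ Set.range fun i => AddMonoidAlgebra.single (m i) (f i)) {μ : LatM N}
    (h : x.coeff μ ≠ 0) : ∃ i, μ = m i ∧ x.coeff μ = f i := by
  classical
  obtain ⟨i, rfl⟩ := hx
  simp only [AddMonoidAlgebra.coeff_single] at h ⊢
  have hμ : μ = m i := by
    by_contra hne
    exact h (Finsupp.single_eq_of_ne hne)
  subst hμ
  exact ⟨i, rfl, Finsupp.single_eq_same⟩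

end Monomials

/-! ### The divisor `𝔇[f]`: semi-ampleness and the first inclusion -/

section GenDivisor

variable {k : Type u} [Field k] [PerfectField k] {C : SmoothCurve k}
  {N : Type v} [AddCommGroup N] [Module.Free ℤ N] [Module.Finite ℤ N]
  {r : ℕ} {f : Fin r → C.RatFun} (hf : ∀ i, f i ≠ 0) {m : Fin r → LatM N}
  (hzero : ∀ g : C.RatFun, AddMonoidAlgebra.single (0 : LatM N) g ∈ genAlgebra C f m →
    g ∈ Set.range (algebraMap C.Reg C.RatFun))

/-- The polyhedral divisor `𝔇[f] = ∑ Δ_z[f] · z`. -/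
def genDivisor : PolyhedralDivisor C (genCone m) where
  coeff z := genPolyhedron C f m z
  isTail z := isTailPolyhedron_of_nonempty m _ (genPolyhedron_nonempty C hf hzero z)
  finite := by
    refine (Set.finite_iUnion fun i => C.finite_ord_ne_zero (hf i)).subset fun z hz => ?_
    by_contra h
    refine hz ?_
    ext v
    have h0 : ∀ i, C.ord z (f i) = 0 := by
      intro i
      by_contra hne
      exact h (Set.mem_iUnion.2 ⟨i, hne⟩)
    simp [genPolyhedron, h0, mem_genCone]

/-- The monomials in the generators compute the divisor `𝔇[f](μ)` up to a multiple. -/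
theorem exists_monomial {μ : LatM N} (hμ : toMQ μ ∈ dualCone (genCone m)) :
    ∃ s : ℕ, 0 < s ∧
      (∀ z, ∃ a : Fin r → ℕ, ∑ i, a i • m i = s • μ ∧
        (C.ord z (∏ i, f i ^ a i) : ℚ) = -(s * (genDivisor hf hzero).eval (toMQ μ) z)) ∧
      ∃ a : Fin r → ℕ, ∑ i, a i • m i = s • μ := by
  -- The zero vector is added to the right-hand sides so that some monomial of degree `s μ` exists
  -- without reference to a point, with the same `s`.
  obtain ⟨s, hs, h⟩ := exists_nat_combination_supportFun m hμ
    ((finite_range_neg_ord C hf).insert 0) (by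
      rintro b (rfl | ⟨z, rfl⟩)
      · exact ⟨0, fun i => by simp⟩
      · exact genPolyhedron_nonempty C hf hzero z)
  refine ⟨s, hs, fun z => ?_, ?_⟩
  · obtain ⟨a, ha, hab⟩ := h _ (Or.inr ⟨z, rfl⟩)
    refine ⟨a, ha, ?_⟩
    rw [ord_prod_pow C hf]
    refine Eq.trans ?_ (congrArg Neg.neg hab)
    push_cast
    rw [← Finset.sum_neg_distrib]
    exact Finset.sum_congr rfl fun i _ => by ring
  · obtain ⟨a, ha, -⟩ := h _ (Or.inl rfl)
    exact ⟨a, ha⟩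

theorem neg_le_ord_monomial {μ : LatM N} (hμ : toMQ μ ∈ dualCone (genCone m)) {s : ℕ}
    {a : Fin r → ℕ} (ha : ∑ i, a i • m i = s • μ) (z : C.Point) :
    -(s * (genDivisor hf hzero).eval (toMQ μ) z) ≤ (C.ord z (∏ i, f i ^ a i) : ℚ) := by
  have h := sum_mul_le_supportFun m ha hμ ((genDivisor hf hzero).isTail z)
  rw [ord_prod_pow C hf]
  refine (neg_le_neg h).trans_eq ?_
  push_cast
  rw [← Finset.sum_neg_distrib]
  exact Finset.sum_congr rfl fun i _ => by ring

theorem isSemiample_genDivisor {μ : LatM N} (hμ : toMQ μ ∈ dualCone (genCone m)) :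
    C.IsSemiample ((genDivisor hf hzero).eval (toMQ μ)) := by
  obtain ⟨s, hs, h, -⟩ := exists_monomial hf hzero hμ
  refine ⟨s, hs, fun z => ?_, fun z => ?_⟩
  · obtain ⟨a, -, ha⟩ := h z
    refine ⟨-C.ord z (∏ i, f i ^ a i), ?_⟩
    push_cast
    rw [ha, neg_neg]
    rfl
  · obtain ⟨a, ham, ha⟩ := h z
    refine ⟨∏ i, f i ^ a i, fun _ z' => ?_, Finset.prod_ne_zero_iff.2 fun i _ =>
      pow_ne_zero _ (hf i), ?_⟩
    · rw [neg_le_ord_iff]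
      exact neg_le_ord_monomial hf hzero hμ ham z'
    · rw [ha, neg_add_cancel]

/-- Two families of Gauss valuations are used: the trivial order with `v ∈ σ` controls the weights,
and `ord_z` with `v` minimizing `μ` on `Δ_z[f]` controls the coefficients. -/
theorem mem_sectionAlgebra_of_isIntegral {x : AddMonoidAlgebra C.RatFun (LatM N)}
    (hx : IsIntegral (genAlgebra C f m) x) : x ∈ (genDivisor hf hzero).sectionAlgebra := by
  have hev : ∀ v : NQ N, ∃ φ : LatM N →+ ℚ, ∀ μ, φ μ = toMQ μ v := fun v =>
    ⟨((LinearMap.applyₗ v : MQ N →ₗ[ℚ] ℚ).toAddMonoidHom).comp toMQHom, fun _ => rfl⟩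
  intro μ hμ
  have hμσ : toMQ μ ∈ dualCone (genCone m) := by
    refine mem_dualCone.2 fun v hv => ?_
    obtain ⟨φ, hφ⟩ := hev v
    have := coeff_bound_of_isIntegral (fun _ : C.RatFun => (0 : ℤ))
      (fun _ _ _ _ => rfl) (fun _ _ _ _ _ => le_rfl) φ (R := C.Reg) _ (fun a ν hν => by
        rw [(coeff_algebraMap_reg hν).1]; simp) (fun y hy ν hν => by
        obtain ⟨i, rfl, -⟩ := coeff_generator hy hν
        rw [hφ]
        simpa using (mem_genCone m).1 hv i) hx μ hμ
    simpa [hφ] using this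
  refine ⟨hμσ, fun _ z => ?_⟩
  rw [neg_le_ord_iff]
  obtain ⟨v, hv, hvμ⟩ := exists_supportFun_eq ((genDivisor hf hzero).isTail z) hμσ
  obtain ⟨φ, hφ⟩ := hev v
  have := coeff_bound_of_isIntegral (C.ord z) (fun _ _ => C.ord_mul z)
    (fun _ _ _ _ => C.ord_add z) φ (R := C.Reg) _ (fun a ν hν => by
      rw [(coeff_algebraMap_reg hν).1, (coeff_algebraMap_reg ((coeff_algebraMap_reg hν).1 ▸ hν)).2]
      simpa using C.ord_algebraMap_nonneg z a) (fun y hy ν hν => by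
      obtain ⟨i, rfl, h⟩ := coeff_generator hy hν
      rw [h, hφ]
      have := hv i
      linarith) hx μ hμ
  rw [hφ, hvμ] at this
  change -supportFun _ _ ≤ _
  linarith

theorem genAlgebra_subset_sectionAlgebra {x : AddMonoidAlgebra C.RatFun (LatM N)}
    (hx : x ∈ genAlgebra C f m) : x ∈ (genDivisor hf hzero).sectionAlgebra :=
  mem_sectionAlgebra_of_isIntegral hf hzero
    (isIntegral_algebraMap (x := (⟨x, hx⟩ : genAlgebra C f m)))

end GenDivisor

/-! ### Sections are integral over `A` -/

section Normalization

variable {k : Type u} [Field k] [IsAlgClosed k] [CharZero k] {C : SmoothCurve k}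
  {N : Type v} [AddCommGroup N] [Module.Free ℤ N] [Module.Finite ℤ N]
  {r : ℕ} {f : Fin r → C.RatFun} (hf : ∀ i, f i ≠ 0) {m : Fin r → LatM N}
  (hzero : ∀ g : C.RatFun, AddMonoidAlgebra.single (0 : LatM N) g ∈ genAlgebra C f m →
    g ∈ Set.range (algebraMap C.Reg C.RatFun))

theorem isIntegral_of_mem_sectionAlgebra {x : AddMonoidAlgebra C.RatFun (LatM N)}
    (hx : x ∈ (genDivisor hf hzero).sectionAlgebra) :
    IsIntegral (genAlgebra C f m)
      (algebraMap _ (FractionRing (AddMonoidAlgebra C.RatFun (LatM N))) x) := by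
  set F := FractionRing (AddMonoidAlgebra C.RatFun (LatM N))
  suffices h : ∀ (μ : LatM N) (g : C.RatFun), g ≠ 0 → toMQ μ ∈ dualCone (genCone m) →
      g ∈ C.sections ((genDivisor hf hzero).eval (toMQ μ)) →
      IsIntegral (genAlgebra C f m)
        (algebraMap _ F (AddMonoidAlgebra.single μ g)) by
    rw [← AddMonoidAlgebra.sum_coeff_single x, Finsupp.sum, map_sum]
    refine IsIntegral.sum _ fun μ hμ => ?_
    have hμ' := Finsupp.mem_support_iff.1 hμ
    exact h μ _ hμ' (hx μ hμ').1 (hx μ hμ').2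
  intro μ g hg hμ hgs
  let A' : Subring F := ((genAlgebra C f m).toSubring).map
    (algebraMap (AddMonoidAlgebra C.RatFun (LatM N)) F)
  -- The integral closure is the intersection of the valuation rings of `F` containing `A`, so one
  -- such ring `V` is treated at a time.
  have hmem : algebraMap _ F (AddMonoidAlgebra.single μ g) ∈
      ⨅ V : {V : ValuationSubring F // (A' : Set F) ⊆ V.toSubring}, V.1.toSubring := by
    rw [Subring.mem_iInf]
    rintro ⟨V, hV⟩
    change _ ∈ V
    have hVA : ∀ y ∈ genAlgebra C f m, algebraMap _ F y ∈ V := fun y hy => hV ⟨y, hy, rfl⟩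
    let ι : C.RatFun →+* F := (algebraMap (AddMonoidAlgebra C.RatFun (LatM N)) F).comp
      (algebraMap C.RatFun (AddMonoidAlgebra C.RatFun (LatM N)))
    let W : ValuationSubring C.RatFun := V.comap ι
    have hW : ∀ a : C.Reg, algebraMap C.Reg C.RatFun a ∈ W := by
      intro a
      have := hVA _ ((genAlgebra C f m).algebraMap_mem a)
      rw [IsScalarTower.algebraMap_apply C.Reg C.RatFun] at this
      exact this
    have key : ∃ s : ℕ, 0 < s ∧ ∃ a : Fin r → ℕ, ∑ i, a i • m i = s • μ ∧
        g ^ s * (∏ i, f i ^ a i)⁻¹ ∈ W := by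
      obtain ⟨s, hs, h1, h2⟩ := exists_monomial hf hzero hμ
      refine ⟨s, hs, ?_⟩
      -- If `V` contains all of `k(C)`, any monomial of degree `s μ` will do; otherwise the one that
      -- is optimal at the centre `z` is needed.
      rcases C.eq_top_or_exists_localRing_le W hW with htop | ⟨z, hz⟩
      · obtain ⟨a, ha⟩ := h2
        exact ⟨a, ha, htop ▸ ValuationSubring.mem_top _⟩
      · obtain ⟨a, ha, hord⟩ := h1 z
        refine ⟨a, ha, hz ?_⟩
        have hp : ∏ i, f i ^ a i ≠ 0 := Finset.prod_ne_zero_iff.2 fun i _ => pow_ne_zero _ (hf i)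
        rw [C.mem_localRing, C.ord_mul z (pow_ne_zero _ hg) (inv_ne_zero hp), C.ord_inv z hp,
          C.ord_pow z hg]
        have h3 := neg_le_ord_iff.1 (hgs hg z)
        have h4 := mul_le_mul_of_nonneg_left h3 (Nat.cast_nonneg (α := ℚ) s)
        have h5 : (0 : ℚ) ≤ s * C.ord z g + -C.ord z (∏ i, f i ^ a i) := by
          rw [hord]
          linarith
        exact_mod_cast h5
    obtain ⟨s, hs, a, ha, hgW⟩ := key
    have hp : ∏ i, f i ^ a i ≠ 0 := Finset.prod_ne_zero_iff.2 fun i _ => pow_ne_zero _ (hf i)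
    have hpow : algebraMap _ F (AddMonoidAlgebra.single μ g) ^ s ∈ V := by
      rw [← map_pow, AddMonoidAlgebra.single_pow]
      have h1 : AddMonoidAlgebra.single (s • μ) (g ^ s) =
          algebraMap C.RatFun (AddMonoidAlgebra C.RatFun (LatM N)) (g ^ s * (∏ i, f i ^ a i)⁻¹) *
            AddMonoidAlgebra.single (∑ i, a i • m i) (∏ i, f i ^ a i) := by
        rw [AddMonoidAlgebra.coe_algebraMap, Function.comp_apply, Algebra.algebraMap_self_apply,
          AddMonoidAlgebra.single_mul_single, zero_add, ha, inv_mul_cancel_right₀ hp]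
      rw [h1, map_mul]
      exact V.mul_mem _ _ hgW (hVA _ (single_prod_mem_genAlgebra C f m a))
    have hint : IsIntegral V (algebraMap _ F (AddMonoidAlgebra.single μ g)) :=
      IsIntegral.of_pow hs (isIntegral_algebraMap (x := (⟨_, hpow⟩ : V)))
    obtain ⟨y, hy⟩ := IsIntegrallyClosed.isIntegral_iff.1 hint
    rw [← hy]
    exact y.2
  rw [iInf_valuationSubring_superset] at hmem
  have hint : IsIntegral (Subring.closure (A' : Set F))
      (algebraMap _ F (AddMonoidAlgebra.single μ g)) := hmem
  rw [Subring.closure_eq] at hint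
  have hinj : Function.Injective (algebraMap (AddMonoidAlgebra C.RatFun (LatM N)) F) :=
    IsFractionRing.injective _ _
  let e : (genAlgebra C f m).toSubring ≃+* A' := Subring.equivMapOfInjective _ _ hinj
  obtain ⟨p, hp, hpx⟩ := hint
  refine ⟨p.map e.symm.toRingHom, hp.map _, ?_⟩
  rw [Polynomial.eval₂_map]
  have hcomp : (algebraMap (genAlgebra C f m) F).comp e.symm.toRingHom = algebraMap A' F := by
    refine RingHom.ext fun a => ?_
    obtain ⟨b, rfl⟩ := e.surjective a
    change algebraMap (genAlgebra C f m) F (e.symm (e b)) = _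
    rw [e.symm_apply_apply]
    rfl
  rw [hcomp]
  exact hpx

theorem isNormalization_genDivisor :
    IsNormalization C (genAlgebra C f m) (genDivisor hf hzero).sectionAlgebra := by
  have hic : IsIntegrallyClosed (AddMonoidAlgebra C.RatFun (LatM N)) :=
    AddMonoidAlgebra.isIntegrallyClosed_of_free
  refine Set.Subset.antisymm (fun y hy => ?_) ?_
  · have hy' : IsIntegral (genAlgebra C f m) y := hy
    -- Integral elements already lie in `k(C)[M]`, since that ring is integrally closed.
    obtain ⟨x, rfl⟩ := IsIntegrallyClosed.isIntegral_iff.1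
      (hy'.tower_top (A := AddMonoidAlgebra C.RatFun (LatM N)))
    refine ⟨x, mem_sectionAlgebra_of_isIntegral hf hzero ?_, rfl⟩
    exact (isIntegral_algebraMap_iff (IsFractionRing.injective _ _)).1 hy'
  · rintro _ ⟨x, hx, rfl⟩
    exact isIntegral_of_mem_sectionAlgebra hf hzero hx

end Normalization

/-! ### Uniqueness of the divisor -/

section Uniqueness

variable {k : Type u} [Field k] {C : SmoothCurve k} {N : Type v} [AddCommGroup N]
  {σ : PointedCone ℚ (NQ N)}

theorem PolyhedralDivisor.eval_nsmul (D : PolyhedralDivisor C σ) {μ : LatM N}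
    (hμ : toMQ μ ∈ dualCone σ) (s : ℕ) : D.eval (toMQ (s • μ)) = (s : ℚ) • D.eval (toMQ μ) := by
  funext z
  rw [toMQ_nsmul]
  exact supportFun_smul (D.isTail z) hμ (Nat.cast_nonneg s)

/-- A divisor with semi-ample evaluations is determined by its algebra of sections. -/
theorem PolyhedralDivisor.coeff_subset_of_sectionAlgebra_subset [Module.Free ℤ N]
    [Module.Finite ℤ N] (hσ : σ.FG) {D D' : PolyhedralDivisor C σ}
    (hD : ∀ μ : LatM N, toMQ μ ∈ dualCone σ → C.IsSemiample (D.eval (toMQ μ)))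
    (h : D.sectionAlgebra ⊆ D'.sectionAlgebra) (z : C.Point) : D'.coeff z ⊆ D.coeff z := by
  classical
  refine subset_of_supportFun_le hσ (D.isTail z) (D'.isTail z) fun μ hμ => ?_
  obtain ⟨s, hs, -, hg⟩ := hD μ hμ
  -- Here `ord_z g = -s 𝔇(μ)(z)` exactly, so membership of `g χ^{sμ}` in the other algebra bounds
  -- the other evaluation at `z` from below.
  obtain ⟨g, hgs, hg0, hgz⟩ := hg z
  have hmem : AddMonoidAlgebra.single (s • μ) g ∈ D.sectionAlgebra := by
    intro ν hν
    rw [AddMonoidAlgebra.coeff_single] at hν ⊢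
    have hνs : ν = s • μ := by
      by_contra hne
      exact hν (Finsupp.single_eq_of_ne hne)
    subst hνs
    rw [Finsupp.single_eq_same, D.eval_nsmul hμ, toMQ_nsmul]
    exact ⟨smul_mem_dualCone hμ (Nat.cast_nonneg s), hgs⟩
  have h1 := (h hmem (s • μ) (by simpa [AddMonoidAlgebra.coeff_single] using hg0)).2
  rw [AddMonoidAlgebra.coeff_single, Finsupp.single_eq_same, D'.eval_nsmul hμ] at h1
  have h2 := neg_le_ord_iff.1 (h1 hg0 z)
  have hs' : (0 : ℚ) < s := by exact_mod_cast hs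
  have h3 : (s : ℚ) * D.eval (toMQ μ) z ≤ s * D'.eval (toMQ μ) z := by
    rw [Pi.smul_apply, smul_eq_mul] at h2
    linarith
  exact le_of_mul_le_mul_left h3 hs'

theorem PolyhedralDivisor.eq_of_sectionAlgebra_eq [Module.Free ℤ N] [Module.Finite ℤ N]
    (hσ : σ.FG) {D D' : PolyhedralDivisor C σ} (hD : D.IsProper) (hD' : D'.IsProper)
    (h : D.sectionAlgebra = D'.sectionAlgebra) : D = D' := by
  refine PolyhedralDivisor.ext (funext fun z => Set.Subset.antisymm ?_ ?_)
  · exact coeff_subset_of_sectionAlgebra_subset hσ (fun μ hμ => (hD' μ hμ).1) h.ge z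
  · exact coeff_subset_of_sectionAlgebra_subset hσ (fun μ hμ => (hD μ hμ).1) h.le z

end Uniqueness

/-! ### Strong convexity from the fraction field -/

section FractionField

variable {k : Type u} [Field k] {C : SmoothCurve k}
  {N : Type v} [AddCommGroup N] [Module.Free ℤ N] [Module.Finite ℤ N]
  {r : ℕ} {f : Fin r → C.RatFun} {m : Fin r → LatM N}

theorem exists_mul_mem_genAlgebra (hfrac : IsFractionRing (genAlgebra C f m)
      (FractionRing (AddMonoidAlgebra C.RatFun (LatM N)))) (x : AddMonoidAlgebra C.RatFun (LatM N)) :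
    ∃ b ∈ genAlgebra C f m, b ≠ 0 ∧ x * b ∈ genAlgebra C f m := by
  have hinj := IsFractionRing.injective (AddMonoidAlgebra C.RatFun (LatM N))
    (FractionRing (AddMonoidAlgebra C.RatFun (LatM N)))
  obtain ⟨a, b, hb, hab⟩ := IsFractionRing.div_surjective (A := genAlgebra C f m)
    (algebraMap _ (FractionRing (AddMonoidAlgebra C.RatFun (LatM N))) x)
  have hb0 : (b : AddMonoidAlgebra C.RatFun (LatM N)) ≠ 0 := fun h =>
    nonZeroDivisors.ne_zero hb (Subtype.ext h)
  refine ⟨b, b.2, hb0, ?_⟩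
  have hb1 : algebraMap (genAlgebra C f m)
      (FractionRing (AddMonoidAlgebra C.RatFun (LatM N))) b ≠ 0 := fun h =>
    hb0 (hinj (h.trans (map_zero _).symm))
  rw [div_eq_iff hb1] at hab
  have : (a : AddMonoidAlgebra C.RatFun (LatM N)) = x * b :=
    hinj (hab.trans (map_mul _ _ _).symm)
  rw [← this]
  exact a.2

/-- If `x` and `-x` lie in `σ`, all weights of `A` vanish at `x`. Multiplying `χ^ν` by a denominator
in `A` shows that every `ν ∈ M` is a difference of weights of `A`, so all of `M` vanishes at `x`. -/
theorem genCone_salient [PerfectField k] (hf : ∀ i, f i ≠ 0)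
    (hzero : ∀ g : C.RatFun, AddMonoidAlgebra.single (0 : LatM N) g ∈ genAlgebra C f m →
      g ∈ Set.range (algebraMap C.Reg C.RatFun))
    (hfrac : IsFractionRing (genAlgebra C f m)
      (FractionRing (AddMonoidAlgebra C.RatFun (LatM N)))) :
    (genCone m : ConvexCone ℚ (NQ N)).Salient := by
  intro x hx hx0 hnx
  have hvan : ∀ κ : LatM N, toMQ κ ∈ dualCone (genCone m) → toMQ κ x = 0 := by
    intro κ hκ
    have h1 := mem_dualCone.1 hκ x hx
    have h2 := mem_dualCone.1 hκ (-x) hnx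
    rw [map_neg] at h2
    linarith
  have hall : ∀ ν : LatM N, toMQ ν x = 0 := by
    intro ν
    obtain ⟨b, hb, hb0, hxb⟩ := exists_mul_mem_genAlgebra hfrac (AddMonoidAlgebra.single ν 1)
    obtain ⟨κ, hκ⟩ : ∃ κ, b.coeff κ ≠ 0 := by
      by_contra! h
      exact hb0 (AddMonoidAlgebra.coeff_inj.1 (Finsupp.ext h))
    have h1 := hvan κ (genAlgebra_subset_sectionAlgebra hf hzero hb κ hκ).1
    have h2 := hvan (ν + κ) (genAlgebra_subset_sectionAlgebra hf hzero hxb (ν + κ) (by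
      rw [AddMonoidAlgebra.coeff_single_mul_add, one_mul]; exact hκ)).1
    rw [toMQ_add, LinearMap.add_apply, h1, add_zero] at h2
    exact h2
  refine hx0 ((Module.forall_dual_apply_eq_zero_iff ℚ x).1 fun l => ?_)
  obtain ⟨n, hn, ν, hν⟩ := exists_nsmul_eq_toMQ (N := N) l
  have h1 := hall ν
  rw [hν, LinearMap.smul_apply, smul_eq_mul] at h1
  exact (mul_eq_zero.1 h1).resolve_left (by exact_mod_cast hn.ne')

end FractionField

/-! ### Bigness in the relative interior -/

section Big

/-- The segment from `ν` to `μ` can be prolonged to `μ + ε (μ - ν)` inside the cone; multiplying by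
the denominator of `ε` makes this a lattice point. -/
theorem exists_nsmul_sub_mem_dualCone {N : Type v} [AddCommGroup N] {σ : PointedCone ℚ (NQ N)} {μ ν : LatM N}
    (hμ : toMQ μ ∈ relInterior (dualCone σ : Set (MQ N))) (hν : toMQ ν ∈ dualCone σ) :
    ∃ (n p : ℕ) (lam : LatM N), 0 < n ∧ 0 < p ∧ toMQ lam ∈ dualCone σ ∧ n • μ = lam + p • ν := by
  obtain ⟨ε, hε, h⟩ := hμ.2 _ hν
  have hp : 0 < ε.num.toNat := by
    rw [Int.lt_toNat]
    exact_mod_cast Rat.num_pos.2 hε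
  have hnum : (ε.num.toNat : ℚ) = ε.den * ε := by
    have h1 : ((ε.num.toNat : ℤ) : ℚ) = ε.num := by
      rw [Int.toNat_of_nonneg (Rat.num_pos.2 hε).le]
    rw [Rat.den_mul_eq_num, ← h1]
    rfl
  refine ⟨ε.den + ε.num.toNat, ε.num.toNat, (ε.den + ε.num.toNat) • μ - ε.num.toNat • ν,
    by positivity, hp, ?_, (sub_add_cancel _ _).symm⟩
  have h2 := smul_mem_dualCone h (c := ε.den) (by positivity)
  convert h2 using 1
  rw [← toMQHom_apply, map_sub, toMQHom_apply, toMQHom_apply, toMQ_nsmul, toMQ_nsmul]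
  push_cast
  rw [hnum]
  module

theorem le_rank_span_of_transcendental {k : Type u} [Field k] {C : SmoothCurve k} {t w : C.RatFun} (ht : Transcendental k t) (hw : w ≠ 0)
    {S : Set C.RatFun} {n : ℕ} (hS : ∀ i < n, t ^ i * w ∈ S) :
    (n : Cardinal.{u}) ≤ Module.rank k (Submodule.span k S) := by
  have hli : LinearIndependent k fun i : Fin n => t ^ (i : ℕ) * w := by
    rw [Fintype.linearIndependent_iff]
    intro c hc i
    have h1 : Polynomial.aeval t (∑ i : Fin n, Polynomial.monomial (i : ℕ) (c i)) = 0 := by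
      refine (mul_eq_zero.1 ?_).resolve_right hw
      rw [← hc, map_sum, Finset.sum_mul]
      exact Finset.sum_congr rfl fun j _ => by
        rw [Polynomial.aeval_monomial, ← Algebra.smul_def, smul_mul_assoc]
    have h2 := congrArg (fun p => p.coeff (i : ℕ)) (transcendental_iff.1 ht _ h1)
    simpa [Polynomial.finsetSum_coeff, Polynomial.coeff_monomial, Fin.val_inj] using h2
  let v : Fin n → Submodule.span k S := fun i =>
    ⟨t ^ (i : ℕ) * w, Submodule.subset_span (hS i i.2)⟩
  have hv : LinearIndependent k v := LinearIndependent.of_comp (Submodule.span k S).subtype hli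
  simpa using hv.cardinal_lift_le_rank

variable {k : Type u} [Field k] [IsAlgClosed k] [CharZero k] {C : SmoothCurve k}
  {N : Type v} [AddCommGroup N] [Module.Free ℤ N] [Module.Finite ℤ N]
  {r : ℕ} {f : Fin r → C.RatFun} (hf : ∀ i, f i ≠ 0) {m : Fin r → LatM N}
  (hzero : ∀ g : C.RatFun, AddMonoidAlgebra.single (0 : LatM N) g ∈ genAlgebra C f m →
    g ∈ Set.range (algebraMap C.Reg C.RatFun))

/-- A denominator `b ∈ A` of a transcendental `t` has the same weights as `t b`; a nonzero
coefficient `u` of `b` and the coefficient `t u` of `t b` are then sections of the same degree. -/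
theorem exists_transcendental_ratio (hfrac : IsFractionRing (genAlgebra C f m)
      (FractionRing (AddMonoidAlgebra C.RatFun (LatM N)))) :
    ∃ (ν : LatM N) (t u : C.RatFun), Transcendental k t ∧ t ≠ 0 ∧ u ≠ 0 ∧
      toMQ ν ∈ dualCone (genCone m) ∧
      ∀ z, -(genDivisor hf hzero).eval (toMQ ν) z ≤ C.ord z u ∧
        -(genDivisor hf hzero).eval (toMQ ν) z ≤ C.ord z (t * u) := by
  obtain ⟨t, ht⟩ := C.exists_transcendental
  have ht0 : t ≠ 0 := by rintro rfl; exact ht isAlgebraic_zero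
  obtain ⟨b, hb, hb0, hxb⟩ := exists_mul_mem_genAlgebra hfrac (AddMonoidAlgebra.single 0 t)
  obtain ⟨ν, hν⟩ : ∃ ν, b.coeff ν ≠ 0 := by
    by_contra! h
    exact hb0 (AddMonoidAlgebra.coeff_inj.1 (Finsupp.ext h))
  have h1 := genAlgebra_subset_sectionAlgebra hf hzero hb ν hν
  have hν' : t * b.coeff ν ≠ 0 := mul_ne_zero ht0 hν
  have h2 := genAlgebra_subset_sectionAlgebra hf hzero hxb ν
  rw [AddMonoidAlgebra.coeff_single_zero_mul] at h2
  exact ⟨ν, t, b.coeff ν, ht, ht0, hν, h1.1, fun z =>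
    ⟨neg_le_ord_iff.1 (h1.2 hν z), neg_le_ord_iff.1 ((h2 hν').2 hν' z)⟩⟩

theorem isBig_genDivisor (hfrac : IsFractionRing (genAlgebra C f m)
      (FractionRing (AddMonoidAlgebra C.RatFun (LatM N)))) {μ : LatM N}
    (hμ : toMQ μ ∈ relInterior (dualCone (genCone m) : Set (MQ N))) :
    C.IsBig ((genDivisor hf hzero).eval (toMQ μ)) := by
  set D := genDivisor hf hzero with hD
  obtain ⟨s₀, hs₀, hint, -⟩ := isSemiample_genDivisor hf hzero hμ.1
  obtain ⟨ν, t, u, ht, ht0, hu, hν, hord⟩ := exists_transcendental_ratio hf hzero hfrac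
  obtain ⟨n, p, lam, hn, hp, hlam, hsum⟩ := exists_nsmul_sub_mem_dualCone hμ hν
  obtain ⟨s, hs, -, a, ha⟩ := exists_monomial hf hzero hlam
  set w := ∏ i, f i ^ a i with hw
  have hw0 : w ≠ 0 := Finset.prod_ne_zero_iff.2 fun i _ => pow_ne_zero _ (hf i)
  have hwz := neg_le_ord_monomial hf hzero hlam ha
  -- The factor `s₀` makes the multiple integral, `s` provides a monomial `w` of degree `s λ`, and
  -- `n` splits `n μ` as `λ + p ν`.
  refine ⟨s₀ * s * n, by positivity, fun z => ?_, 1, Eventually.of_forall fun R => ?_⟩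
  · obtain ⟨e, he⟩ := hint z
    refine ⟨s * n * e, ?_⟩
    push_cast
    rw [← he]
    simp only [Pi.smul_apply, smul_eq_mul]
    ring
  · rw [Nat.cast_one, one_mul]
    refine le_rank_span_of_transcendental (w := u ^ (R * s₀ * s * p) * w ^ (R * s₀)) ht
      (mul_ne_zero (pow_ne_zero _ hu) (pow_ne_zero _ hw0)) fun i hi _ z => ?_
    rw [neg_le_ord_iff]
    -- The section has `R s₀ s p` factors `u`; replacing `i` of them by `t u` keeps the degree and
    -- multiplies by `t ^ i`. This gives `R` independent sections, so the constant `1` suffices.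
    have hiN : i ≤ R * s₀ * s * p := by
      have : 0 < s₀ * s * p := by positivity
      calc i ≤ R := hi.le
        _ ≤ R * (s₀ * s * p) := Nat.le_mul_of_pos_right R this
        _ = _ := by ring
    obtain ⟨j, hj⟩ := Nat.exists_eq_add_of_le hiN
    have hsec : t ^ i * (u ^ (R * s₀ * s * p) * w ^ (R * s₀)) =
        (t * u) ^ i * u ^ j * w ^ (R * s₀) := by
      rw [hj, pow_add, mul_pow]
      ring
    have htu := mul_ne_zero ht0 hu
    rw [hsec, C.ord_mul z (mul_ne_zero (pow_ne_zero _ htu) (pow_ne_zero _ hu)) (pow_ne_zero _ hw0),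
      C.ord_mul z (pow_ne_zero _ htu) (pow_ne_zero _ hu), C.ord_pow z htu, C.ord_pow z hu,
      C.ord_pow z hw0]
    have hadd : D.eval (toMQ lam) z + p * D.eval (toMQ ν) z ≤ n * D.eval (toMQ μ) z := by
      have h1 := supportFun_add_le (D.isTail z) hlam
        (smul_mem_dualCone hν (Nat.cast_nonneg (α := ℚ) p))
      rw [← toMQ_nsmul, ← toMQ_add, ← hsum, toMQ_nsmul, toMQ_nsmul,
        supportFun_smul (D.isTail z) hν (Nat.cast_nonneg _),
        supportFun_smul (D.isTail z) hμ.1 (Nat.cast_nonneg _)] at h1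
      exact h1
    have h1 := mul_le_mul_of_nonneg_left (hord z).2 (Nat.cast_nonneg (α := ℚ) i)
    have h2 := mul_le_mul_of_nonneg_left (hord z).1 (Nat.cast_nonneg (α := ℚ) j)
    have h3 := mul_le_mul_of_nonneg_left (hwz z) (Nat.cast_nonneg (α := ℚ) (R * s₀))
    have h4 := mul_le_mul_of_nonneg_left hadd (Nat.cast_nonneg (α := ℚ) (R * s₀ * s))
    have h5 : ((R * s₀ * s * p : ℕ) : ℚ) = i + j := by exact_mod_cast hj
    have h6 : ((R * s₀ * s * p : ℕ) : ℚ) * D.eval (toMQ ν) z = (i + j) * D.eval (toMQ ν) z := by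
      rw [h5]
    simp only [Pi.smul_apply, smul_eq_mul]
    push_cast at *
    linarith

theorem isProper_genDivisor (hfrac : IsFractionRing (genAlgebra C f m)
      (FractionRing (AddMonoidAlgebra C.RatFun (LatM N)))) :
    (genDivisor hf hzero).IsProper := fun _ hμ =>
  ⟨isSemiample_genDivisor hf hzero hμ, isBig_genDivisor hf hzero hfrac⟩

end Big

/-! ### The main theorem -/

theorem mainTheorem3 {k : Type u} [Field k] [IsAlgClosed k] [CharZero k] (C : SmoothCurve k)
    {N : Type v} [AddCommGroup N] [Module.Free ℤ N] [Module.Finite ℤ N]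
    {r : ℕ} (f : Fin r → C.RatFun) (hf : ∀ i, f i ≠ 0) (m : Fin r → LatM N)
    (hfrac : IsFractionRing (genAlgebra C f m)
      (FractionRing (AddMonoidAlgebra C.RatFun (LatM N))))
    (hzero : ∀ g : C.RatFun, AddMonoidAlgebra.single (0 : LatM N) g ∈ genAlgebra C f m →
      g ∈ Set.range (algebraMap C.Reg C.RatFun)) :
    ((genCone m).FG ∧ (genCone m : ConvexCone ℚ (NQ N)).Salient) ∧
    ∃ D : PolyhedralDivisor C (genCone m),
      (∀ z, D.coeff z = genPolyhedron C f m z) ∧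
      D.IsProper ∧
      IsNormalization C (genAlgebra C f m) D.sectionAlgebra ∧
      ∀ D' : PolyhedralDivisor C (genCone m), D'.IsProper →
        IsNormalization C (genAlgebra C f m) D'.sectionAlgebra → D' = D := by
  have hproper := isProper_genDivisor hf hzero hfrac
  have hnorm := isNormalization_genDivisor hf hzero
  refine ⟨⟨genCone_fg m, genCone_salient hf hzero hfrac⟩, genDivisor hf hzero, fun _ => rfl,
    hproper, hnorm, fun D' hD' hnorm' => ?_⟩
  refine PolyhedralDivisor.eq_of_sectionAlgebra_eq (genCone_fg m) hD' hproper ?_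
  exact (IsFractionRing.injective (AddMonoidAlgebra C.RatFun (LatM N))
    (FractionRing (AddMonoidAlgebra C.RatFun (LatM N)))).image_injective (hnorm'.symm.trans hnorm)
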